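/- A triangulation is a finite collection of tetrahedra $i(0123)$ some or all of whose faces are affinely glued in pairs, such that no face is glued to itself and no edge is identified with itself in reverse; $i(abc)\mapsto j(def)$ denotes the gluing of face $abc$ of tetrahedron $i$ to face $def$ of tetrahedron $j$ with $a\mapsto d$, $b\mapsto e$, $c\mapsto f$. It is closed if every face is glued, and 1-vertex if all tetrahedron vertices are identified. A normal surface is given by its normal coordinates, a vector of $7n$ non-negative integers (four triangle and three quadrilateral counts per tetrahedron) that satisfies the matching equations and has at most one non-zero quadrilateral count per tetrahedron; it is a vertex normal surface if it is non-zero, spans an extremal ray of the cone of all non-negative real solutions of the matching equations, and is the smallest non-zero integer point on this ray. For $m\ge 1$ let $\mathcal B_m$ be the layered solid torus $\mathrm{LST}(F_{m+1},F_{m+2},F_{m+3})$ with $m$ tetrahedra $0,\dots,m-1$ and gluings $0(023)\mapsto 0(231)$, $(i+1)(023)\mapsto i(120)$ and $(i+1)(123)\mapsto i(013)$ for $0\le i<m-1$. Let $\mathcal E$ be the triangulation with four tetrahedra and gluings $$\begin{array}{c|cccc} i & i(012) & i(013) & i(023) & i(123)\\ \hline 0&2(231)&1(230)&2(023)&1(123)\\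 1&3(012)&2(102)&0(301)&0(123)\\ 2&1(103)&3(230)&0(023)&0(201)\\ 3&1(012)&\partial&2(301)&\partial\end{array}$$ where $\partial$ marks the two boundary faces. Theorem. There is a family $(\mathcal C_n)_{n\ge 5}$ such that for each $n\ge 5$: $\mathcal C_n$ is a closed 1-vertex triangulation with $n$ tetrahedra of a closed 3-manifold (all vertex links are spheres), it is obtained by gluing $\mathcal B_{n-4}$ and $\mathcal E$ along their boundaries by an isomorphism of the boundary complexes, and it contains a vertex normal surface which - if $n\equiv 2 \pmod 3$, is a projective plane with maximum normal coordinate at least $F_{n-3}$; - if $n\not\equiv 2 \pmod 3$, is a sphere with maximum normal coordinate at least $2F_{n-3}$. Here $F_k$ is the $k$-th Fibonacci number ($F_0=0$, $F_1=1$). -/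

import Mathlib

namespace NormalSurf

/-! ### Generalised triangulations -/

/-- Raw face gluings of a family of tetrahedra `ι`, each with vertices `0, 1, 2, 3`; face `f` of a
tetrahedron is the triangle opposite vertex `f`.  `g t f = none` says that face `f` of `t` is a
boundary face.  `g t f = some (u, σ)` says that it is glued to face `σ f` of `u`, each
vertex `v ≠ f` of the face going to vertex `σ v` of `u`. -/
abbrev Gluing (ι : Type*) := ι → Fin 4 → Option (ι × Equiv.Perm (Fin 4))

variable {ι κ lam : Type*}

/-- The oriented edge `a → b` of tetrahedron `t` is carried to `a' → b'` of `t'` by the gluing of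
one face containing it. Oriented edges are triples `(t, a, b)` with `a ≠ b`. -/
def EdgeStep (g : Gluing ι) (p q : ι × Fin 4 × Fin 4) : Prop :=
  p.2.1 ≠ p.2.2 ∧ ∃ (f : Fin 4) (σ : Equiv.Perm (Fin 4)), p.2.1 ≠ f ∧ p.2.2 ≠ f ∧
    g p.1 f = some (q.1, σ) ∧ q.2.1 = σ p.2.1 ∧ q.2.2 = σ p.2.2

/-- Identification of oriented edges generated by the gluings. -/
def EdgeRel (g : Gluing ι) : ι × Fin 4 × Fin 4 → ι × Fin 4 × Fin 4 → Prop :=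
  Relation.EqvGen (EdgeStep g)

/-- A (generalised) triangulation: faces are glued in pairs, no face to itself, and no
edge is identified with itself in reverse. -/
structure Triangulation (ι : Type*) where
  glue : Gluing ι
  glue_symm : ∀ t f u σ, glue t f = some (u, σ) → glue u (σ f) = some (t, σ.symm)
  glue_ne : ∀ t f u σ, glue t f = some (u, σ) → ¬ (u = t ∧ σ f = f)
  no_reverse : ∀ t a b, a ≠ b → ¬ EdgeRel glue (t, a, b) (t, b, a)

/-- An antisymmetric nonzero invariant of oriented edges excludes reversed edges. -/
theorem no_reverse_of_label (g : Gluing ι) (L : ι → Fin 4 → Fin 4 → ℤ)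
    (hL : ∀ t a b, a ≠ b → L t a b ≠ 0 ∧ L t b a = - L t a b)
    (hg : ∀ t f u σ, g t f = some (u, σ) → ∀ a b, a ≠ b → a ≠ f → b ≠ f →
      L u (σ a) (σ b) = L t a b) :
    ∀ t a b, a ≠ b → ¬ EdgeRel g (t, a, b) (t, b, a) := by
  have key : ∀ p q, EdgeRel g p q → L p.1 p.2.1 p.2.2 = L q.1 q.2.1 q.2.2 := by
    intro p q h
    induction h with
    | rel p q h =>
      obtain ⟨hne, f, σ, h1, h2, h3, h4, h5⟩ := h
      rw [h4, h5]
      exact (hg _ _ _ _ h3 _ _ hne h1 h2).symm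
    | refl p => rfl
    | symm p q _ ih => exact ih.symm
    | trans p q r _ _ ih1 ih2 => exact ih1.trans ih2
  intro t a b hab h
  have h1 := key _ _ h
  have h2 := hL t a b hab
  simp only at h1
  omega

namespace Triangulation

/-- No boundary faces. -/
def IsClosed (T : Triangulation ι) : Prop := ∀ t f, T.glue t f ≠ none

/-- Vertex `v` of `t` is carried to vertex `v'` of `t'` by the gluing of a face containing it. -/
def VertexStep (T : Triangulation ι) (p q : ι × Fin 4) : Prop :=
  ∃ (f : Fin 4) (σ : Equiv.Perm (Fin 4)), p.2 ≠ f ∧ T.glue p.1 f = some (q.1, σ) ∧ q.2 = σ p.2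

/-- Identification of tetrahedron vertices generated by the gluings. -/
def VertexRel (T : Triangulation ι) : ι × Fin 4 → ι × Fin 4 → Prop :=
  Relation.EqvGen T.VertexStep

/-- There is exactly one vertex. -/
def IsOneVertex (T : Triangulation ι) : Prop :=
  Nonempty ι ∧ ∀ p q, T.VertexRel p q

/-- `T` is obtained from `T₁` and `T₂` by gluing them along their entire boundaries: up to a
relabelling `e` of tetrahedra, `T` keeps all gluings of `T₁` and `T₂`, each boundary face of one is
glued to a boundary face of the other, and the resulting bijection of boundary faces is an
isomorphism of the boundary complexes (two oriented edges of boundary faces are identified in `T₁`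
iff their images are identified in `T₂`). -/
def IsBoundaryUnion (T₁ : Triangulation ι) (T₂ : Triangulation κ) (T : Triangulation lam) : Prop :=
  ∃ e : ι ⊕ κ ≃ lam,
    (∀ t f u σ, T₁.glue t f = some (u, σ) →
      T.glue (e (.inl t)) f = some (e (.inl u), σ)) ∧
    (∀ t f u σ, T₂.glue t f = some (u, σ) →
      T.glue (e (.inr t)) f = some (e (.inr u), σ)) ∧
    (∀ t f, T₁.glue t f = none → ∃ u σ, T₂.glue u (σ f) = none ∧
      T.glue (e (.inl t)) f = some (e (.inr u), σ)) ∧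
    (∀ t f, T₂.glue t f = none → ∃ u σ, T₁.glue u (σ f) = none ∧
      T.glue (e (.inr t)) f = some (e (.inl u), σ)) ∧
    (∀ t f u σ t' f' u' σ', T₁.glue t f = none → T₁.glue t' f' = none →
      T.glue (e (.inl t)) f = some (e (.inr u), σ) →
      T.glue (e (.inl t')) f' = some (e (.inr u'), σ') →
      ∀ a b a' b', a ≠ b → a ≠ f → b ≠ f → a' ≠ b' → a' ≠ f' → b' ≠ f' →
        (EdgeRel T₁.glue (t, a, b) (t', a', b') ↔
          EdgeRel T₂.glue (u, σ a, σ b) (u', σ' a', σ' b')))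

end Triangulation

/-! ### Normal coordinates -/

/-- The seven types of normal pieces: `inl v` is the triangle cutting off vertex `v`; `inr q` is the
quadrilateral separating `{0, q + 1}` from the two other vertices. -/
abbrev Disc := Fin 4 ⊕ Fin 3

/-- The quadrilateral type separating `{a, b}` from the other two vertices (for `a ≠ b`; the
diagonal values are irrelevant). -/
def quadOf (a b : Fin 4) : Fin 3 :=
  ![![0, 0, 1, 2], ![0, 0, 2, 1], ![1, 2, 0, 0], ![2, 1, 0, 0]] a b

/-- Number of normal arcs in face `f` cutting off the vertex `v ≠ f` of that face. -/
def arcCount {R : Type*} [Add R] (y : Disc → R) (f v : Fin 4) : R :=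
  y (.inl v) + y (.inr (quadOf v f))

/-- Number of intersection points with the edge `ab`, `a ≠ b`. -/
def edgeWeight (y : Disc → ℕ) (a b : Fin 4) : ℕ :=
  y (.inl a) + y (.inl b) + ∑ q ∈ Finset.univ.filter (fun q : Fin 3 => q ≠ quadOf a b), y (.inr q)

/-- The pieces of the normal surface with coordinates `x`.  The triangles of type `v` in `t` are
numbered starting from the one closest to `v`, the quadrilaterals starting from the one closest to
vertex `0`. -/
abbrev Piece (x : ι → Disc → ℕ) := Σ (t : ι) (d : Disc), Fin (x t d)

/-- Intersection points of the surface with tetrahedron edges: the `k`-th point, counted from `a`,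
on the edge from `a` to `b` of `t`. -/
structure EdgePoint (x : ι → Disc → ℕ) where
  tet : ι
  a : Fin 4
  b : Fin 4
  k : ℕ
  ne : a ≠ b
  lt : k < edgeWeight (x tet) a b

/-- Normal arcs of the surface in tetrahedron faces: the `k`-th arc, counted from `v`, cutting off
vertex `v` in face `f` of `t`. -/
structure FaceArc (x : ι → Disc → ℕ) where
  tet : ι
  f : Fin 4
  v : Fin 4
  k : ℕ
  ne : v ≠ f
  lt : k < arcCount (x tet) f v

/-- The arc `α` is a side of the piece `p`.  Counting from `v`, the arcs cutting off `v` in face `f`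
are those of the triangles at `v` followed by those of the quadrilaterals separating
`{v, f}` from the other vertices. -/
def IsSide (x : ι → Disc → ℕ) (p : Piece x) (α : FaceArc x) : Prop :=
  α.tet = p.1 ∧
    match p with
    | ⟨_, .inl w, j⟩ => α.v = w ∧ α.k = j
    | ⟨t, .inr q, j⟩ => quadOf α.v α.f = q ∧
        α.k = x t (.inl α.v) +
          if α.v = 0 ∨ α.v = q.succ then (j : ℕ) else x t (.inr q) - 1 - (j : ℕ)

namespace Triangulation

variable (T : Triangulation ι)

/-- The matching equations, one for each arc type of each internal face. -/
def Matching {R : Type*} [Add R] (y : ι → Disc → R) : Prop :=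
  ∀ t f u σ, T.glue t f = some (u, σ) → ∀ v, v ≠ f →
    arcCount (y t) f v = arcCount (y u) (σ f) (σ v)

/-- `x` is the vector of normal coordinates of a normal surface: non-negative integers satisfying
the matching equations and the quadrilateral constraints (at most one type of quadrilateral occurs
in each tetrahedron). -/
def IsNormal (x : ι → Disc → ℕ) : Prop :=
  T.Matching x ∧ ∀ t q q', x t (.inr q) ≠ 0 → x t (.inr q') ≠ 0 → q = q'

/-- The cone of non-negative real solutions of the matching equations. -/
def solutionCone : Set (ι → Disc → ℝ) :=
  {y | (∀ t d, 0 ≤ y t d) ∧ T.Matching y}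

/-- A normal coordinate vector as a real vector. -/
def toReal (x : ι → Disc → ℕ) : ι → Disc → ℝ := fun t d => (x t d : ℝ)

/-- The ray from the origin through `y`. -/
def ray (y : ι → Disc → ℝ) : Set (ι → Disc → ℝ) := {z | ∃ c : ℝ, 0 ≤ c ∧ z = c • y}

/-- `x` is a vertex normal surface: a nonzero normal surface that spans an extremal ray of the
solution cone and is the smallest nonzero integer point of this ray. -/
def IsVertexNormal (x : ι → Disc → ℕ) : Prop :=
  T.IsNormal x ∧ x ≠ 0 ∧ IsExtreme ℝ T.solutionCone (ray (toReal x)) ∧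
    ∀ z : ι → Disc → ℕ, z ≠ 0 → toReal z ∈ ray (toReal x) → x ≤ z

/-- Identification of the edge points of a normal surface, by reading an edge in the opposite
direction and by the face gluings; its quotient is the set of vertices of the surface. -/
def PointStep (x : ι → Disc → ℕ) (p q : EdgePoint x) : Prop :=
  (q.tet = p.tet ∧ q.a = p.b ∧ q.b = p.a ∧ q.k + p.k + 1 = edgeWeight (x p.tet) p.a p.b) ∨
  ∃ (f : Fin 4) (σ : Equiv.Perm (Fin 4)), p.a ≠ f ∧ p.b ≠ f ∧
    T.glue p.tet f = some (q.tet, σ) ∧ q.a = σ p.a ∧ q.b = σ p.b ∧ q.k = p.k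

/-- Identification of the normal arcs of a normal surface by the face gluings; its quotient is
the set of edges of the surface. -/
def ArcStep (x : ι → Disc → ℕ) (α β : FaceArc x) : Prop :=
  ∃ σ : Equiv.Perm (Fin 4), T.glue α.tet α.f = some (β.tet, σ) ∧
    β.f = σ α.f ∧ β.v = σ α.v ∧ β.k = α.k

/-- Euler characteristic (vertices minus edges plus faces) of the normal surface `x` with its cell
structure by normal pieces. -/
noncomputable def eulerChar (x : ι → Disc → ℕ) : ℤ :=
  (Nat.card (Quot (T.PointStep x)) : ℤ) - Nat.card (Quot (T.ArcStep x)) + Nat.card (Piece x)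

/-- Two pieces of a normal surface have sides that are glued together. -/
def PieceAdj (x : ι → Disc → ℕ) (p q : Piece x) : Prop :=
  ∃ α β : FaceArc x, IsSide x p α ∧ IsSide x q β ∧ T.ArcStep x α β

/-- `x` is a non-empty connected normal surface without boundary. -/
def IsClosedConnectedSurface (x : ι → Disc → ℕ) : Prop :=
  T.IsNormal x ∧ (∀ t f v, T.glue t f = none → v ≠ f → arcCount (x t) f v = 0) ∧
    Nonempty (Piece x) ∧ ∀ p q : Piece x, Relation.EqvGen (T.PieceAdj x) p q

/-- The normal surface `x` is a sphere: the closed connected surface of Euler characteristic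
`2`. -/
def IsSphere (x : ι → Disc → ℕ) : Prop :=
  T.IsClosedConnectedSurface x ∧ T.eulerChar x = 2

/-- The normal surface `x` is a projective plane: the closed connected surface of Euler
characteristic `1`. -/
def IsProjectivePlane (x : ι → Disc → ℕ) : Prop :=
  T.IsClosedConnectedSurface x ∧ T.eulerChar x = 1

open Classical in
/-- The link of the vertex represented by `v` in `t`: one normal triangle at every tetrahedron
vertex that is identified with it. -/
noncomputable def vertexLink (t : ι) (v : Fin 4) : ι → Disc → ℕ := fun u d =>
  match d with
  | .inl w => if T.VertexRel (t, v) (u, w) then 1 else 0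
  | .inr _ => 0

/-- `T` triangulates a closed 3-manifold: there is no boundary and each vertex link is a sphere. -/
def IsClosedManifold : Prop :=
  T.IsClosed ∧ ∀ t v, T.IsSphere (T.vertexLink t v)

/-- The maximum coordinate. -/
def maxCoord [Fintype ι] (x : ι → Disc → ℕ) : ℕ :=
  Finset.univ.sup fun p : ι × Disc => x p.1 p.2

end Triangulation

/-! ### The layered solid tori and the plug -/

/-- The permutation with value list `f` and inverse `g`. -/
def mkPerm (f g : Fin 4 → Fin 4) (h₁ : Function.LeftInverse g f := by decide)
    (h₂ : Function.RightInverse g f := by decide) : Equiv.Perm (Fin 4) := ⟨f, g, h₁, h₂⟩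

/-- `(023) ↦ (231)` -/
def foldPerm : Equiv.Perm (Fin 4) := mkPerm ![2, 0, 3, 1] ![1, 3, 0, 2]
/-- `(023) ↦ (120)` -/
def layerPerm₁ : Equiv.Perm (Fin 4) := mkPerm ![1, 3, 2, 0] ![3, 0, 2, 1]
/-- `(123) ↦ (013)` -/
def layerPerm₀ : Equiv.Perm (Fin 4) := mkPerm ![2, 0, 1, 3] ![1, 2, 0, 3]

/-- Gluings of the layered solid torus with `m` tetrahedra: tetrahedron `0` is the one-tetrahedron
solid torus `LST(1,2,3)`, with its faces `(023)` and `(231)` glued; for each `i`, tetrahedron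
`i + 1` is layered on the boundary faces `(012)` and `(013)` of tetrahedron `i` by
`(i+1)(023) ↦ i(120)` and `(i+1)(123) ↦ i(013)`.  This covers the boundary edge
that meets the meridian disc in the fewest points. -/
def layeredGlue (m : ℕ) : Gluing (Fin m) := fun i =>
  ![if (i : ℕ) = 0 then some (i, foldPerm.symm)
      else some (⟨i - 1, (Nat.sub_le _ _).trans_lt i.2⟩, layerPerm₀),
    if (i : ℕ) = 0 then some (i, foldPerm)
      else some (⟨i - 1, (Nat.sub_le _ _).trans_lt i.2⟩, layerPerm₁),
    if h : (i : ℕ) + 1 < m then some (⟨i + 1, h⟩, layerPerm₀.symm) else none,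
    if h : (i : ℕ) + 1 < m then some (⟨i + 1, h⟩, layerPerm₁.symm) else none]

/-- A label of the oriented edges of the layered solid torus, by edge class and direction. -/
def layeredLabel (k : ℕ) : Fin 4 → Fin 4 → ℤ :=
  ![![0, (k + 4 : ℤ), (k + 2 : ℤ), (k + 3 : ℤ)],
    ![-(k + 4 : ℤ), 0, -(k + 3 : ℤ), -(k + 2 : ℤ)],
    ![-(k + 2 : ℤ), (k + 3 : ℤ), 0, (if k = 0 then 2 else k + 1 : ℤ)],
    ![-(k + 3 : ℤ), (k + 2 : ℤ), -(if k = 0 then 2 else k + 1 : ℤ), 0]]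

theorem layeredGlue_eq_some (m : ℕ) (t : Fin m) (f : Fin 4) (u : Fin m)
    (σ : Equiv.Perm (Fin 4)) : layeredGlue m t f = some (u, σ) ↔
      (f = 0 ∧ (t : ℕ) = 0 ∧ (u : ℕ) = 0 ∧ σ = foldPerm.symm) ∨
      (f = 1 ∧ (t : ℕ) = 0 ∧ (u : ℕ) = 0 ∧ σ = foldPerm) ∨
      (f = 0 ∧ (t : ℕ) = u + 1 ∧ σ = layerPerm₀) ∨
      (f = 1 ∧ (t : ℕ) = u + 1 ∧ σ = layerPerm₁) ∨
      (f = 2 ∧ (u : ℕ) = t + 1 ∧ σ = layerPerm₀.symm) ∨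
      (f = 3 ∧ (u : ℕ) = t + 1 ∧ σ = layerPerm₁.symm) := by
  obtain ⟨t, ht⟩ := t
  obtain ⟨u, hu⟩ := u
  fin_cases f <;> simp [layeredGlue] <;> grind

theorem layeredGlue_symm (m : ℕ) (t : Fin m) (f : Fin 4) (u : Fin m) (σ : Equiv.Perm (Fin 4))
    (h : layeredGlue m t f = some (u, σ)) : layeredGlue m u (σ f) = some (t, σ.symm) := by
  rw [layeredGlue_eq_some] at h ⊢
  rcases h with ⟨rfl, h1, h2, rfl⟩ | ⟨rfl, h1, h2, rfl⟩ | ⟨rfl, h, rfl⟩ | ⟨rfl, h, rfl⟩ |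
    ⟨rfl, h, rfl⟩ | ⟨rfl, h, rfl⟩ <;>
  simp [*, foldPerm, layerPerm₀, layerPerm₁, mkPerm]

theorem layeredGlue_ne (m : ℕ) (t : Fin m) (f : Fin 4) (u : Fin m) (σ : Equiv.Perm (Fin 4))
    (h : layeredGlue m t f = some (u, σ)) : ¬ (u = t ∧ σ f = f) := by
  rw [layeredGlue_eq_some] at h
  rw [Fin.ext_iff]
  rcases h with ⟨rfl, h1, h2, rfl⟩ | ⟨rfl, h1, h2, rfl⟩ | ⟨rfl, h, rfl⟩ | ⟨rfl, h, rfl⟩ |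
    ⟨rfl, h, rfl⟩ | ⟨rfl, h, rfl⟩ <;>
  simp [*, foldPerm, layerPerm₀, layerPerm₁, mkPerm]

theorem layeredGlue_label (m : ℕ) (t : Fin m) (f : Fin 4) (u : Fin m) (σ : Equiv.Perm (Fin 4))
    (h : layeredGlue m t f = some (u, σ)) (a b : Fin 4) (hab : a ≠ b) (ha : a ≠ f) (hb : b ≠ f) :
    (-1) ^ (u : ℕ) * layeredLabel u (σ a) (σ b) = (-1) ^ (t : ℕ) * layeredLabel t a b := by
  rw [layeredGlue_eq_some] at h
  rcases h with ⟨rfl, h1, h2, rfl⟩ | ⟨rfl, h1, h2, rfl⟩ | ⟨rfl, h, rfl⟩ | ⟨rfl, h, rfl⟩ |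
    ⟨rfl, h, rfl⟩ | ⟨rfl, h, rfl⟩ <;>
  fin_cases a <;> fin_cases b <;>
  simp [*, foldPerm, layerPerm₀, layerPerm₁, mkPerm, layeredLabel, pow_succ] at hab ha hb ⊢ <;>
  ring

/-- The layered solid torus `LST(F_{m+1}, F_{m+2}, F_{m+3})` with `m` tetrahedra. -/
def layeredSolidTorus (m : ℕ) : Triangulation (Fin m) where
  glue := layeredGlue m
  glue_symm := layeredGlue_symm m
  glue_ne := layeredGlue_ne m
  no_reverse := no_reverse_of_label _ (fun t a b => (-1) ^ (t : ℕ) * layeredLabel t a b)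
    (by
      rintro ⟨t, ht⟩ a b hab
      refine ⟨mul_ne_zero (pow_ne_zero _ (by norm_num)) ?_, ?_⟩
      · fin_cases a <;> fin_cases b <;> simp [layeredLabel] at hab ⊢ <;> (try split_ifs) <;> omega
      · rw [← mul_neg]
        congr 1
        fin_cases a <;> fin_cases b <;> simp [layeredLabel] at hab ⊢)
    (layeredGlue_label m)

/-- `(012) ↦ (231)`, `(013) ↦ (230)` -/
def plugPerm₁ : Equiv.Perm (Fin 4) := mkPerm ![2, 3, 1, 0] ![3, 2, 0, 1]
/-- `(013) ↦ (102)` -/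
def plugPerm₂ : Equiv.Perm (Fin 4) := mkPerm ![1, 0, 3, 2] ![1, 0, 3, 2]

/-- Gluings of the four-tetrahedron plug:
```
     i(012)   i(013)   i(023)   i(123)
 0   2(231)   1(230)   2(023)   1(123)
 1   3(012)   2(102)   0(301)   0(123)
 2   1(103)   3(230)   0(023)   0(201)
 3   1(012)     ∂      2(301)     ∂
```
In the rows below the faces are listed in the order `(123), (023), (013), (012)`. -/
def plugGlue : Gluing (Fin 4) :=
  ![![some (1, 1), some (2, 1), some (1, plugPerm₁), some (2, plugPerm₁)],
    ![some (0, 1), some (0, plugPerm₁.symm), some (2, plugPerm₂), some (3, 1)],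
    ![some (0, plugPerm₁.symm), some (0, 1), some (3, plugPerm₁), some (1, plugPerm₂)],
    ![none, some (2, plugPerm₁.symm), none, some (1, 1)]]

/-- A label of the oriented edges of the plug, by edge class and direction. -/
def plugLabel : Fin 4 → Fin 4 → Fin 4 → ℤ :=
  ![![![0, 1, 2, 3], ![-1, 0, 4, 2], ![-2, -4, 0, 1], ![-3, -2, -1, 0]],
    ![![0, 5, -3, -2], ![-5, 0, 4, 2], ![3, -4, 0, 1], ![2, -2, -1, 0]],
    ![![0, -5, 2, 3], ![5, 0, -2, -4], ![-2, 2, 0, 1], ![-3, 4, -1, 0]],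
    ![![0, 5, -3, 4], ![-5, 0, 4, 6], ![3, -4, 0, -5], ![-4, -6, 5, 0]]]

theorem plugGlue_spec (t f : Fin 4) : ∀ p ∈ plugGlue t f,
    plugGlue p.1 (p.2 f) = some (t, p.2.symm) ∧ ¬ (p.1 = t ∧ p.2 f = f) ∧
    ∀ a b, a ≠ b → a ≠ f → b ≠ f → plugLabel p.1 (p.2 a) (p.2 b) = plugLabel t a b := by
  fin_cases t <;> fin_cases f <;> simp [plugGlue] <;> decide

/-- The four-tetrahedron plug. -/
def plug : Triangulation (Fin 4) where
  glue := plugGlue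
  glue_symm t f u σ h := (plugGlue_spec t f (u, σ) h).1
  glue_ne t f u σ h := (plugGlue_spec t f (u, σ) h).2.1
  no_reverse := no_reverse_of_label _ plugLabel (by decide)
    (fun t f u σ h => (plugGlue_spec t f (u, σ) h).2.2)

end NormalSurf

namespace NormalSurf

variable {ι : Type*}

/-! ### Counting the cells of a normal surface -/

/-! Each layer of the layered solid torus adds one edge, and the meridian disc meets this edge as
often as two older edges together, so its coordinates grow like Fibonacci numbers. The plug closes
the torus with `m + 1` tetrahedra to `capped m`, where n = m + 5. In its boundary faces, `s`
parallel meridian discs leave s F_{m+3} and s F_{m+2} arcs of two types and none of the third. The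
plug extends these arcs by a normal surface in which the first number is halved: a coordinate `p`
with 2p = s F_{m+3} is needed. If 3 divides m + 3, that is n ≡ 2 mod 3, then F_{m+3} is even and s =
1 suffices; otherwise s = 2 and p = F_{m+3} is odd. In both cases `s` and `p` are coprime, and the
last layer has a coordinate s F_{m+2} = s F_{n-3}.

The surface has Euler characteristic `s` (`eulerChar_cappedSurface`), so it is a projective plane or
a sphere once it is connected. Connectedness need not be traced through the pieces: by
`IsVertexNormal.isClosedConnectedSurface`, a component of a vertex normal surface would be another
integer point of the same ray, not above the smallest one. Extremality holds because solutions with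
the same support are determined by one number (`layered_solution`, `plug_solution`).

The remaining topology is controlled by integer labels that classify oriented edges completely
(`cappedLabelling`). They exclude reversed edges, show that the cap is an isomorphism of boundary
complexes, and count the vertices of a normal surface edge by edge. There are n + 1 edge classes,
which forces the link of the single vertex to be a sphere. -/

theorem natCard_piece [Fintype ι] (x : ι → Disc → ℕ) :
    Nat.card (Piece x) = ∑ t, ((∑ v, x t (.inl v)) + ∑ q, x t (.inr q)) := by
  simp [Piece, Nat.card_eq_fintype_card, Fintype.card_sigma]

/-- Normal arcs, sorted by tetrahedron, face and vertex. -/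
def FaceArc.equivSigma (x : ι → Disc → ℕ) : FaceArc x ≃
    Σ (t : ι) (p : {p : Fin 4 × Fin 4 // p.2 ≠ p.1}), Fin (arcCount (x t) p.1.1 p.1.2) where
  toFun α := ⟨α.tet, ⟨(α.f, α.v), α.ne⟩, ⟨α.k, α.lt⟩⟩
  invFun s := ⟨s.1, s.2.1.1.1, s.2.1.1.2, s.2.2, s.2.1.2, s.2.2.2⟩
  left_inv _ := rfl
  right_inv _ := rfl

instance [Finite ι] (x : ι → Disc → ℕ) : Finite (FaceArc x) :=
  Finite.of_equiv _ (FaceArc.equivSigma x).symm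

theorem natCard_faceArc [Fintype ι] (x : ι → Disc → ℕ) :
    Nat.card (FaceArc x) = ∑ t, (3 * (∑ v, x t (.inl v)) + 4 * ∑ q, x t (.inr q)) := by
  rw [Nat.card_congr (FaceArc.equivSigma x), Nat.card_eq_fintype_card, Fintype.card_sigma]
  refine Finset.sum_congr rfl fun t _ => ?_
  rw [Fintype.card_sigma]
  simp only [Fintype.card_fin]
  rw [← Finset.sum_subtype (Finset.univ.filter fun p : Fin 4 × Fin 4 => p.2 ≠ p.1) (by simp)
    (fun p => arcCount (x t) p.1 p.2), Finset.sum_filter, Fintype.sum_prod_type]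
  simp [Fin.sum_univ_four, Fin.sum_univ_three, arcCount, quadOf]
  ring

/-- The quotient by a fixed point free involution has half as many elements. -/
theorem two_mul_natCard_quot {α : Type*} [Finite α] (r : α → α → Prop) (i : α → α)
    (hi : ∀ a, i (i a) = a) (hne : ∀ a, i a ≠ a) (hr : ∀ a b, r a b ↔ b = i a) :
    2 * Nat.card (Quot r) = Nat.card α := by
  classical
  have := Fintype.ofFinite α
  have := Fintype.ofFinite (Quot r)
  have hq : ∀ a b, Quot.mk r b = Quot.mk r a ↔ b = a ∨ b = i a := by
    intro a b
    constructor
    · intro h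
      replace h := Quot.eqvGen_exact h
      induction h with
      | rel a b h => rw [hr] at h; subst h; right; rw [hi]
      | refl => exact Or.inl rfl
      | symm a b _ ih => rcases ih with rfl | rfl <;> simp [hi]
      | trans a b c _ _ ih₁ ih₂ =>
        rcases ih₁ with rfl | rfl <;> rcases ih₂ with rfl | rfl <;> simp [hi]
    · rintro (rfl | rfl)
      · rfl
      · exact (Quot.sound ((hr _ _).2 rfl)).symm
  rw [← Nat.card_congr (Equiv.sigmaFiberEquiv (Quot.mk r)), Nat.card_eq_fintype_card,
    Nat.card_eq_fintype_card, Fintype.card_sigma, Finset.sum_congr rfl (g := fun _ => 2)]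
  · simp [mul_comm]
  · intro c _
    induction c using Quot.ind with
    | mk a =>
      rw [Fintype.card_subtype, ← Finset.card_pair (hne a).symm]
      congr 1
      ext b
      simp [hq]

namespace Triangulation

variable (T : Triangulation ι)

theorem IsClosed.exists_glue {T : Triangulation ι} (h : T.IsClosed) (t : ι) (f : Fin 4) :
    ∃ p, T.glue t f = some p := Option.ne_none_iff_exists'.1 (h t f)

/-- Crossing a face is an involution on arcs by `glue_symm`, without fixed points because no face is
glued to itself. Every edge of the surface thus comes from exactly two sides of pieces. -/
theorem two_mul_natCard_arc [Fintype ι] (hT : T.IsClosed) (x : ι → Disc → ℕ)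
    (hx : T.Matching x) : 2 * Nat.card (Quot (T.ArcStep x)) =
      ∑ t, (3 * (∑ v, x t (.inl v)) + 4 * ∑ q, x t (.inr q)) := by
  rw [← natCard_faceArc]
  choose g hg using hT.exists_glue
  have hs : ∀ t f, g (g t f).1 ((g t f).2 f) = (t, (g t f).2.symm) := fun t f =>
    Option.some.inj ((hg _ _).symm.trans (T.glue_symm t f _ _ (hg t f)))
  refine two_mul_natCard_quot _ (fun α => ⟨(g α.tet α.f).1, (g α.tet α.f).2 α.f,
    (g α.tet α.f).2 α.v, α.k, fun h => α.ne ((g α.tet α.f).2.injective h),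
    (hx _ _ _ _ (hg α.tet α.f) α.v α.ne) ▸ α.lt⟩) ?_ ?_ ?_
  · rintro ⟨t, f, v, k, h₁, h₂⟩
    simp [hs]
  · rintro ⟨t, f, v, k, h₁, h₂⟩ h
    simp only [FaceArc.mk.injEq] at h
    exact T.glue_ne _ _ _ _ (hg t f) ⟨h.1, h.2.1⟩
  · rintro ⟨t, f, v, k, h₁, h₂⟩ ⟨t', f', v', k', h₁', h₂'⟩
    simp only [ArcStep, FaceArc.mk.injEq]
    constructor
    · rintro ⟨σ, h, rfl, rfl, rfl⟩
      rw [hg] at h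
      simp only [Option.some.injEq] at h
      simp [h]
    · rintro ⟨rfl, rfl, rfl, rfl⟩
      exact ⟨_, hg t f, rfl, rfl, rfl⟩

/-- Integer labels of the oriented edges that are equal exactly for identified oriented edges and
opposite for opposite orientations; `S` is the set of positive labels. -/
structure EdgeLabelling (T : Triangulation ι) (S : Finset ℕ) where
  label : ι → Fin 4 → Fin 4 → ℤ
  ne_zero : ∀ t a b, a ≠ b → label t a b ≠ 0
  swap : ∀ t a b, a ≠ b → label t b a = - label t a b
  step : ∀ t f u σ, T.glue t f = some (u, σ) → ∀ a b, a ≠ b → a ≠ f → b ≠ f →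
    label u (σ a) (σ b) = label t a b
  complete : ∀ t a b t' a' b', a ≠ b → a' ≠ b' → label t a b = label t' a' b' →
    EdgeRel T.glue (t, a, b) (t', a', b')
  mem_iff : ∀ l : ℕ, l ∈ S ↔ ∃ t a b, a ≠ b ∧ label t a b = l

variable {T}

/-- The first two conjuncts strengthen the induction: in the transitive case the intermediate edge
must be nondegenerate and of the same weight, so that it also carries a point in position `k`. -/
theorem EdgeLabelling.eqvGen_point {S : Finset ℕ} (E : EdgeLabelling T S) (x : ι → Disc → ℕ)
    (w : ℕ → ℕ) (hw : ∀ t a b, a ≠ b → edgeWeight (x t) a b = w (E.label t a b).natAbs)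
    (P Q : ι × Fin 4 × Fin 4) (h : EdgeRel T.glue P Q) :
    (P.2.1 ≠ P.2.2 ↔ Q.2.1 ≠ Q.2.2) ∧
    (P.2.1 ≠ P.2.2 → E.label P.1 P.2.1 P.2.2 = E.label Q.1 Q.2.1 Q.2.2) ∧
    ∀ p q : EdgePoint x, (p.tet, p.a, p.b) = P → (q.tet, q.a, q.b) = Q → p.k = q.k →
      Relation.EqvGen (T.PointStep x) p q := by
  induction h with
  | rel P Q h =>
    obtain ⟨t, a, b⟩ := P
    obtain ⟨t', a', b'⟩ := Q
    obtain ⟨hne, f, σ, h₁, h₂, h₃, h₄, h₅⟩ := h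
    simp only at hne h₁ h₂ h₃ h₄ h₅
    subst h₄ h₅
    refine ⟨by simp [hne], fun _ => (E.step _ _ _ _ h₃ _ _ hne h₁ h₂).symm, ?_⟩
    rintro ⟨pt, pa, pb, pk, p₁, p₂⟩ ⟨qt, qa, qb, qk, q₁, q₂⟩ hp hq hk
    simp only [Prod.mk.injEq] at hp hq hk
    obtain ⟨rfl, rfl, rfl⟩ := hp
    obtain ⟨rfl, rfl, rfl⟩ := hq
    subst hk
    exact .rel _ _ (Or.inr ⟨f, σ, h₁, h₂, h₃, rfl, rfl, rfl⟩)
  | refl P =>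
    refine ⟨Iff.rfl, fun _ => rfl, ?_⟩
    rintro ⟨pt, pa, pb, pk, p₁, p₂⟩ ⟨qt, qa, qb, qk, q₁, q₂⟩ hp hq hk
    subst hp
    simp only [Prod.mk.injEq] at hq hk
    obtain ⟨rfl, rfl, rfl⟩ := hq
    subst hk
    exact .refl _
  | symm P Q _ ih =>
    refine ⟨ih.1.symm, fun h => (ih.2.1 (ih.1.2 h)).symm, fun p q hp hq hk => ?_⟩
    exact .symm _ _ (ih.2.2 q p hq hp hk.symm)
  | trans P Q R _ _ ih₁ ih₂ =>
    refine ⟨ih₁.1.trans ih₂.1, fun h => (ih₁.2.1 h).trans (ih₂.2.1 (ih₁.1.1 h)), ?_⟩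
    intro p q hp hq hk
    subst hp
    have hne := ih₁.1.1 p.ne
    refine .trans _ ⟨Q.1, Q.2.1, Q.2.2, p.k, hne, ?_⟩ _ (ih₁.2.2 _ _ rfl rfl rfl)
      (ih₂.2.2 _ _ rfl hq hk)
    rw [hw _ _ _ hne, ← ih₁.2.1 p.ne, ← hw _ _ _ p.ne]
    exact p.lt

theorem edgeWeight_comm (y : Disc → ℕ) (a b : Fin 4) : edgeWeight y b a = edgeWeight y a b := by
  have : quadOf b a = quadOf a b := by revert a b; decide
  rw [edgeWeight, edgeWeight, this, add_comm (y (.inl b))]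

/-- The vertices of a normal surface, counted edge by edge. -/
theorem EdgeLabelling.natCard_point {S : Finset ℕ} (E : EdgeLabelling T S) (x : ι → Disc → ℕ)
    (w : ℕ → ℕ) (hw : ∀ t a b, a ≠ b → edgeWeight (x t) a b = w (E.label t a b).natAbs) :
    Nat.card (Quot (T.PointStep x)) = ∑ l ∈ S, w l := by
  -- Normal form of a vertex of the surface: its edge class, and its position counted along the
  -- orientation with positive label.
  let F : EdgePoint x → Σ _ : ℕ, ℕ := fun p =>
    ⟨(E.label p.tet p.a p.b).natAbs, if 0 < E.label p.tet p.a p.b then p.k else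
      w (E.label p.tet p.a p.b).natAbs - 1 - p.k⟩
  have hF : ∀ p q, T.PointStep x p q → F p = F q := by
    rintro ⟨t, a, b, k, h₁, h₂⟩ ⟨t', a', b', k', h₁', h₂'⟩ (h | ⟨f, σ, ha, hb, hg, h₃, h₄, h₅⟩)
    · simp only at h
      obtain ⟨rfl, rfl, rfl, h⟩ := h
      have h0 := E.ne_zero t' a' b' h₁'
      rw [hw _ _ _ h₁] at h
      simp only [F, E.swap t' a' b' h₁', Int.natAbs_neg] at h ⊢
      congr 1
      split_ifs <;> omega
    · simp only at ha hb hg h₃ h₄ h₅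
      subst h₃ h₄ h₅
      simp only [F, E.step _ _ _ _ hg _ _ h₁ ha hb]
  have hpos : ∀ p, ∃ p', Relation.EqvGen (T.PointStep x) p p' ∧
      0 < E.label p'.tet p'.a p'.b := by
    intro p
    by_cases h : 0 < E.label p.tet p.a p.b
    · exact ⟨p, .refl _, h⟩
    · have h0 := E.ne_zero p.tet _ _ p.ne
      have hlt := p.lt
      refine ⟨⟨p.tet, p.b, p.a, edgeWeight (x p.tet) p.a p.b - 1 - p.k, p.ne.symm, ?_⟩,
        .rel _ _ (Or.inl ⟨rfl, rfl, rfl, ?_⟩), ?_⟩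
      · rw [edgeWeight_comm _ p.a p.b]
        omega
      · simp only
        omega
      · simp only [E.swap _ _ _ p.ne]
        omega
  have hinj : Function.Injective (Quot.lift F hF) := by
    intro P Q
    induction P using Quot.ind with
    | mk p =>
    induction Q using Quot.ind with
    | mk q =>
    obtain ⟨p', hp, hp0⟩ := hpos p
    obtain ⟨q', hq, hq0⟩ := hpos q
    rw [Quot.eqvGen_sound hp, Quot.eqvGen_sound hq]
    simp only [F, Sigma.mk.injEq, hp0, hq0, if_true]
    rintro ⟨h, hk⟩
    exact Quot.eqvGen_sound ((E.eqvGen_point x w hw _ _ (E.complete _ _ _ _ _ _ p'.ne q'.ne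
      (by omega))).2.2 p' q' rfl rfl (eq_of_heq hk))
  have hrange : Set.range (Quot.lift F hF) = ↑(S.sigma fun l => Finset.range (w l)) := by
    ext ⟨l, k⟩
    simp only [Set.mem_range, Finset.coe_sigma, Set.mem_sigma_iff, Finset.mem_coe,
      Finset.mem_range, E.mem_iff]
    constructor
    · rintro ⟨P, hP⟩
      induction P using Quot.ind with
      | mk p =>
      obtain ⟨p', hp, hp0⟩ := hpos p
      rw [Quot.eqvGen_sound hp] at hP
      simp only [F, Sigma.mk.injEq, hp0, if_true] at hP
      obtain ⟨rfl, hk⟩ := hP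
      refine ⟨⟨p'.tet, p'.a, p'.b, p'.ne, by omega⟩, ?_⟩
      rw [← hw _ _ _ p'.ne, ← eq_of_heq hk]
      exact p'.lt
    · rintro ⟨⟨t, a, b, hab, hl⟩, hk⟩
      have h0 := E.ne_zero t a b hab
      refine ⟨Quot.mk _ ⟨t, a, b, k, hab, ?_⟩, ?_⟩
      · rw [hw _ _ _ hab, hl]
        exact hk
      · have h1 : (E.label t a b).natAbs = l := by omega
        have h2 : 0 < E.label t a b := by omega
        simp only [F, h1, h2, if_true]
  rw [Nat.card_congr (Equiv.ofInjective _ hinj), hrange, Nat.card_eq_fintype_card]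
  simp

/-- Euler characteristic of a normal surface in a closed triangulation: vertices minus half the
number of triangles minus the number of quadrilaterals. -/
theorem EdgeLabelling.two_mul_eulerChar [Fintype ι] {S : Finset ℕ} (E : EdgeLabelling T S)
    (hT : T.IsClosed) (x : ι → Disc → ℕ) (hx : T.Matching x)
    (w : ℕ → ℕ) (hw : ∀ t a b, a ≠ b → edgeWeight (x t) a b = w (E.label t a b).natAbs) :
    2 * T.eulerChar x = 2 * (∑ l ∈ S, w l : ℕ) -
      (∑ t, ((∑ v, x t (.inl v)) + 2 * ∑ q, x t (.inr q)) : ℕ) := by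
  have h₁ := E.natCard_point x w hw
  have h₂ := T.two_mul_natCard_arc hT x hx
  have h₃ := natCard_piece x
  rw [eulerChar, h₁]
  simp only [Finset.sum_add_distrib, ← Finset.mul_sum] at h₂ h₃ ⊢
  omega

/-! ### Connectedness of vertex normal surfaces -/

theorem exists_isSide (x : ι → Disc → ℕ) (α : FaceArc x) : ∃ p, IsSide x p α := by
  have h := α.lt
  rw [arcCount] at h
  by_cases hk : α.k < x α.tet (.inl α.v)
  · exact ⟨⟨α.tet, .inl α.v, ⟨α.k, hk⟩⟩, rfl, rfl, rfl⟩
  -- Quadrilaterals are numbered from vertex 0, so their order seen from `v` is reversed when `v`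
  -- lies on the side opposite to 0.
  · by_cases h0 : α.v = 0 ∨ α.v = (quadOf α.v α.f).succ
    · refine ⟨⟨α.tet, .inr (quadOf α.v α.f), ⟨α.k - x α.tet (.inl α.v), by omega⟩⟩, rfl, rfl, ?_⟩
      rw [if_pos h0]
      simp only
      omega
    · refine ⟨⟨α.tet, .inr (quadOf α.v α.f), ⟨x α.tet (.inr (quadOf α.v α.f)) - 1 -
        (α.k - x α.tet (.inl α.v)), by omega⟩⟩, rfl, rfl, ?_⟩
      rw [if_neg h0]
      simp only
      omega

open Classical in
/-- The coordinates of a set of pieces. -/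
noncomputable def coordOf (x : ι → Disc → ℕ) (K : Set (Piece x)) : ι → Disc → ℕ := fun t d =>
  (Finset.univ.filter fun j : Fin (x t d) => (⟨t, d, j⟩ : Piece x) ∈ K).card

theorem coordOf_add_compl (x : ι → Disc → ℕ) (K : Set (Piece x)) (t : ι) (d : Disc) :
    coordOf x K t d + coordOf x Kᶜ t d = x t d := by
  classical
  simp only [coordOf, Set.mem_compl_iff]
  rw [Finset.card_filter_add_card_filter_not]
  simp

theorem coordOf_pos {x : ι → Disc → ℕ} {K : Set (Piece x)} {p : Piece x} (hp : p ∈ K) :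
    0 < coordOf x K p.1 p.2.1 :=
  Finset.card_pos.2 ⟨p.2.2, by simpa using hp⟩

-- Face gluings preserve positions of arcs. Writing the arc count of a set of pieces as the size of
-- a set of positions therefore reduces its matching equations to an equality of two sets.
open Classical in
theorem arcCount_coordOf (x : ι → Disc → ℕ) (K : Set (Piece x)) (t : ι) (f v : Fin 4)
    (h : v ≠ f) : arcCount (coordOf x K t) f v =
      ((Finset.range (arcCount (x t) f v)).filter fun k =>
        ∃ α : FaceArc x, α.tet = t ∧ α.f = f ∧ α.v = v ∧ α.k = k ∧ ∃ p ∈ K, IsSide x p α).card := by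
  rw [arcCount, coordOf, coordOf, ← Finset.card_disjSum]
  refine Finset.card_bij (fun s _ => Sum.elim (fun j : Fin _ => (j : ℕ))
    (fun j : Fin _ => x t (.inl v) +
    if v = 0 ∨ v = (quadOf v f).succ then (j : ℕ) else x t (.inr (quadOf v f)) - 1 - (j : ℕ)) s)
    ?_ ?_ ?_
  · rintro (j | j) hj
    · simp only [Finset.inl_mem_disjSum, Finset.mem_filter, Finset.mem_univ, true_and] at hj
      have hlt : (j : ℕ) < arcCount (x t) f v := j.2.trans_le (Nat.le_add_right _ _)
      simp only [Sum.elim_inl, Finset.mem_filter, Finset.mem_range]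
      exact ⟨hlt, ⟨t, f, v, j, h, hlt⟩, rfl, rfl, rfl, rfl, _, hj, rfl, rfl, rfl⟩
    · simp only [Finset.inr_mem_disjSum, Finset.mem_filter, Finset.mem_univ, true_and] at hj
      have hlt : (x t (.inl v) + if v = 0 ∨ v = (quadOf v f).succ then (j : ℕ)
          else x t (.inr (quadOf v f)) - 1 - (j : ℕ)) < arcCount (x t) f v := by
        have := j.2
        rw [arcCount]
        split_ifs <;> omega
      simp only [Sum.elim_inr, Finset.mem_filter, Finset.mem_range]
      exact ⟨hlt, ⟨t, f, v, _, h, hlt⟩, rfl, rfl, rfl, rfl, _, hj, rfl, rfl, rfl⟩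
  · rintro (j | j) _ (j' | j') _ he
    · simp only [Sum.elim_inl] at he
      rw [Fin.ext he]
    · have := j.2
      simp only [Sum.elim_inl, Sum.elim_inr] at he
      omega
    · have := j'.2
      simp only [Sum.elim_inl, Sum.elim_inr] at he
      omega
    · have := j.2
      have := j'.2
      simp only [Sum.elim_inr] at he
      congr 1
      ext
      split_ifs at he <;> omega
  · intro k hk
    simp only [Finset.mem_filter] at hk
    obtain ⟨-, ⟨t', f', v', k', h₁, h₂⟩, rfl, rfl, rfl, rfl, ⟨t'', d, j⟩, hp, hs, hs'⟩ := hk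
    simp only at hs
    subst hs
    cases d with
    | inl w' =>
      simp only at hs'
      obtain ⟨rfl, rfl⟩ := hs'
      exact ⟨.inl j, by simpa using hp, rfl⟩
    | inr q =>
      simp only at hs'
      obtain ⟨rfl, hs'⟩ := hs'
      exact ⟨.inr j, by simpa using hp, hs'.symm⟩

/-- Two arcs that are glued together are sides of adjacent pieces, so `K` contains the piece on one
side if and only if it contains the piece on the other. The converse inclusion is the same argument
for the inverse gluing. -/
theorem matching_coordOf (x : ι → Disc → ℕ) (hx : T.Matching x) (K : Set (Piece x))
    (hK : ∀ p q, T.PieceAdj x p q → (p ∈ K ↔ q ∈ K)) : T.Matching (coordOf x K) := by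
  classical
  have key : ∀ t f u σ, T.glue t f = some (u, σ) → ∀ v, v ≠ f → ∀ k,
      (∃ α : FaceArc x, α.tet = t ∧ α.f = f ∧ α.v = v ∧ α.k = k ∧ ∃ p ∈ K, IsSide x p α) →
      ∃ α : FaceArc x, α.tet = u ∧ α.f = σ f ∧ α.v = σ v ∧ α.k = k ∧
        ∃ p ∈ K, IsSide x p α := by
    rintro _ _ u σ hg _ - _ ⟨α, rfl, rfl, rfl, rfl, p, hp, hs⟩
    let β : FaceArc x := ⟨u, σ α.f, σ α.v, α.k, fun h => α.ne (σ.injective h),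
      (hx _ _ _ _ hg α.v α.ne) ▸ α.lt⟩
    obtain ⟨q, hq⟩ := exists_isSide x β
    exact ⟨β, rfl, rfl, rfl, rfl, q, (hK p q ⟨α, β, hs, hq, σ, hg, rfl, rfl, rfl⟩).1 hp, hq⟩
  intro t f u σ hg v hv
  rw [arcCount_coordOf x K t f v hv,
    arcCount_coordOf x K u (σ f) (σ v) fun h => hv (σ.injective h), hx _ _ _ _ hg v hv]
  congr 1
  refine Finset.filter_congr fun k _ => ⟨key t f u σ hg v hv k, fun h => ?_⟩
  simpa using key u (σ f) t σ.symm (T.glue_symm _ _ _ _ hg) (σ v)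
    (fun h => hv (σ.injective h)) k h

theorem toReal_mem_solutionCone {x : ι → Disc → ℕ} (hx : T.Matching x) :
    toReal x ∈ T.solutionCone := by
  refine ⟨fun t d => Nat.cast_nonneg _, fun t f u σ hg v hv => ?_⟩
  have := hx t f u σ hg v hv
  simp only [arcCount, toReal] at this ⊢
  exact_mod_cast this

/-- The component `K` of `p` and its complement split `x` into two solutions. By extremality `K`
lies on the ray of `x`, and by minimality it has at least the coordinates of `x`, so nothing remains
for the complement. -/
theorem IsVertexNormal.isClosedConnectedSurface {x : ι → Disc → ℕ} (h : T.IsVertexNormal x)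
    (hT : T.IsClosed) : T.IsClosedConnectedSurface x := by
  obtain ⟨hx, h0, hext, hmin⟩ := h
  refine ⟨hx, fun t f v hg _ => absurd hg (hT t f), ?_, fun p q => ?_⟩
  · by_contra hp
    rw [not_nonempty_iff] at hp
    refine h0 (funext fun t => funext fun d => ?_)
    by_contra hd
    exact hp.false ⟨t, d, ⟨0, Nat.pos_of_ne_zero hd⟩⟩
  let K : Set (Piece x) := {q | Relation.EqvGen (T.PieceAdj x) p q}
  have hK : ∀ q r, T.PieceAdj x q r → (q ∈ K ↔ r ∈ K) := fun q r hqr =>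
    ⟨fun h => .trans _ _ _ h (.rel _ _ hqr), fun h => .trans _ _ _ h (.symm _ _ (.rel _ _ hqr))⟩
  have hK' : ∀ q r, T.PieceAdj x q r → (q ∈ Kᶜ ↔ r ∈ Kᶜ) := fun q r hqr => not_congr (hK q r hqr)
  have hdouble : ∀ y : ι → Disc → ℝ, y ∈ T.solutionCone → (2 : ℝ) • y ∈ T.solutionCone := by
    rintro y ⟨hy, hm⟩
    refine ⟨fun t d => mul_nonneg zero_le_two (hy t d), fun t f u σ hg v hv => ?_⟩
    have := hm t f u σ hg v hv
    simp only [arcCount, Pi.smul_apply, smul_eq_mul, ← mul_add] at this ⊢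
    rw [this]
  -- Extremality concerns interior points of segments, and `x` is the midpoint of the doubles of its
  -- two parts.
  have hray : (2 : ℝ) • toReal (coordOf x K) ∈ ray (toReal x) := by
    refine hext.2 (hdouble _ (toReal_mem_solutionCone (matching_coordOf x hx.1 K hK)))
      (hdouble _ (toReal_mem_solutionCone (matching_coordOf x hx.1 Kᶜ hK')))
      ⟨1, zero_le_one, (one_smul ℝ (toReal x)).symm⟩
      ⟨1 / 2, 1 / 2, by norm_num, by norm_num, by norm_num, ?_⟩
    ext t d
    simp only [Pi.add_apply, Pi.smul_apply, smul_eq_mul, toReal, ← coordOf_add_compl x K t d,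
      Nat.cast_add]
    ring
  have hne : coordOf x K ≠ 0 := by
    intro h
    have hp : p ∈ K := Relation.EqvGen.refl p
    exact (coordOf_pos hp).ne' (congrFun (congrFun h p.1) p.2.1)
  have hle := hmin _ hne (by
    obtain ⟨c, hc, h⟩ := hray
    refine ⟨c / 2, by positivity, ?_⟩
    rw [div_eq_inv_mul, mul_smul, ← h, smul_smul]
    norm_num)
  by_contra hq
  have hc := coordOf_add_compl x K q.1 q.2.1
  have hpos : 0 < coordOf x Kᶜ q.1 q.2.1 := coordOf_pos hq
  have : x q.1 q.2.1 ≤ coordOf x K q.1 q.2.1 := hle q.1 q.2.1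
  omega

/-- A vector of the solution cone spans an extremal ray if the solutions that vanish where it does
are its multiples. -/
theorem isExtreme_ray {x : ι → Disc → ℝ} (hx : x ∈ T.solutionCone)
    (h : ∀ y ∈ T.solutionCone, (∀ t d, x t d = 0 → y t d = 0) → y ∈ ray x) :
    IsExtreme ℝ T.solutionCone (ray x) := by
  refine ⟨?_, ?_⟩
  · rintro _ ⟨c, hc, rfl⟩
    refine ⟨fun t d => mul_nonneg hc (hx.1 t d), fun t f u σ hg v hv => ?_⟩
    have := hx.2 t f u σ hg v hv
    simp only [arcCount, Pi.smul_apply, smul_eq_mul, ← mul_add] at this ⊢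
    rw [this]
  · rintro y hy z hz _ ⟨c, -, rfl⟩ ⟨a, b, ha, hb, -, he⟩
    refine h y hy fun t d h0 => ?_
    have he := congrFun (congrFun he t) d
    simp only [Pi.add_apply, Pi.smul_apply, smul_eq_mul, h0, mul_zero] at he
    have h1 := hy.1 t d
    have h2 := mul_nonneg hb.le (hz.1 t d)
    have h3 := mul_nonneg ha.le h1
    have h4 : a * y t d = 0 := by linarith
    exact (mul_eq_zero.1 h4).resolve_left (ne_of_gt ha)

/-! ### Vertex links in one-vertex triangulations -/

theorem IsOneVertex.vertexLink_eq (h : T.IsOneVertex) (t : ι) (v : Fin 4) :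
    T.vertexLink t v = fun _ => Sum.elim (fun _ => 1) (fun _ => 0) := by
  funext u d
  cases d <;> simp [vertexLink, h.2]

/-- With n tetrahedra, the link consists of 4n triangles and meets each edge twice, so its Euler
characteristic is 2|S| - 2n, which is 2 for n + 1 edges. It is connected because a chain of vertex
identifications is also a chain of adjacent triangles. -/
theorem IsOneVertex.isClosedManifold [Fintype ι] (h : T.IsOneVertex) (hT : T.IsClosed)
    {S : Finset ℕ} (E : EdgeLabelling T S) (hS : S.card = Fintype.card ι + 1) :
    T.IsClosedManifold := by
  refine ⟨hT, fun t v => ?_⟩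
  rw [h.vertexLink_eq]
  have hm : T.Matching (fun _ => Sum.elim (fun _ => 1) (fun _ => 0) : ι → Disc → ℕ) :=
    fun t f u σ hg v hv => rfl
  refine ⟨⟨⟨hm, fun t q q' hq => absurd rfl hq⟩, fun t f v hg _ => absurd hg (hT t f),
    ⟨⟨t, .inl v, ⟨0, Nat.zero_lt_one⟩⟩⟩, ?_⟩, ?_⟩
  · have key : ∀ P Q, T.VertexRel P Q → Relation.EqvGen
        (T.PieceAdj (fun _ => Sum.elim (fun _ => 1) (fun _ => 0)))
        ⟨P.1, .inl P.2, ⟨0, Nat.zero_lt_one⟩⟩ ⟨Q.1, .inl Q.2, ⟨0, Nat.zero_lt_one⟩⟩ := by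
      intro P Q hPQ
      induction hPQ with
      | rel P Q hPQ =>
        obtain ⟨f, σ, hf, hg, hq⟩ := hPQ
        refine .rel _ _ ⟨⟨P.1, f, P.2, 0, hf, Nat.zero_lt_one⟩, ⟨Q.1, σ f, Q.2, 0, ?_,
          Nat.zero_lt_one⟩, ⟨rfl, rfl, rfl⟩, ⟨rfl, rfl, rfl⟩, σ, hg, rfl, hq, rfl⟩
        rw [hq]
        exact fun h => hf (σ.injective h)
      | refl => exact .refl _
      | symm P Q _ ih => exact .symm _ _ ih
      | trans P Q R _ _ ih₁ ih₂ => exact .trans _ _ _ ih₁ ih₂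
    rintro ⟨t, d | d, j⟩ ⟨u, d' | d', j'⟩
    · have hj : j = ⟨0, Nat.zero_lt_one⟩ := Subsingleton.elim (α := Fin 1) _ _
      have hj' : j' = ⟨0, Nat.zero_lt_one⟩ := Subsingleton.elim (α := Fin 1) _ _
      rw [hj, hj']
      exact key (t, d) (u, d') (h.2 _ _)
    · exact absurd j'.2 (Nat.not_lt_zero _)
    · exact absurd j.2 (Nat.not_lt_zero _)
    · exact absurd j.2 (Nat.not_lt_zero _)
  · have := E.two_mul_eulerChar hT _ hm (fun _ => 2) (fun t a b _ => by simp [edgeWeight])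
    simp [hS] at this
    omega

end Triangulation

/-! ### Edge classes of the layered solid tori -/

theorem EdgeRel.trans {g : Gluing ι} {p q r : ι × Fin 4 × Fin 4} (h₁ : EdgeRel g p q)
    (h₂ : EdgeRel g q r) : EdgeRel g p r := Relation.EqvGen.trans _ _ _ h₁ h₂

theorem EdgeRel.symm {g : Gluing ι} {p q : ι × Fin 4 × Fin 4} (h : EdgeRel g p q) :
    EdgeRel g q p := Relation.EqvGen.symm _ _ h

theorem EdgeRel.of_glue {g : Gluing ι} {t u : ι} {f : Fin 4} {σ : Equiv.Perm (Fin 4)}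
    (h : g t f = some (u, σ)) {a b : Fin 4} (hab : a ≠ b) (ha : a ≠ f) (hb : b ≠ f) :
    EdgeRel g (t, a, b) (u, σ a, σ b) :=
  .rel _ _ ⟨hab, f, σ, ha, hb, h, rfl, rfl⟩

/-- Labels that are preserved by the gluings are constant on edge classes. -/
theorem EdgeRel.label_eq {g : Gluing ι} {p q : ι × Fin 4 × Fin 4} (h : EdgeRel g p q)
    (L : ι → Fin 4 → Fin 4 → ℤ)
    (hg : ∀ t f u σ, g t f = some (u, σ) → ∀ a b, a ≠ b → a ≠ f → b ≠ f →
      L u (σ a) (σ b) = L t a b) : L p.1 p.2.1 p.2.2 = L q.1 q.2.1 q.2.2 := by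
  induction h with
  | rel p q h =>
    obtain ⟨hne, f, σ, h1, h2, h3, h4, h5⟩ := h
    rw [h4, h5]
    exact (hg _ _ _ _ h3 _ _ hne h1 h2).symm
  | refl p => rfl
  | symm p q _ ih => exact ih.symm
  | trans p q r _ _ ih1 ih2 => exact ih1.trans ih2

/-- The invariant of oriented edges of the layered solid torus that separates their classes. -/
def signedLabel (k : ℕ) (a b : Fin 4) : ℤ := (-1) ^ k * layeredLabel k a b

theorem natAbs_signedLabel (k : ℕ) (a b : Fin 4) :
    (signedLabel k a b).natAbs = (layeredLabel k a b).natAbs := by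
  simp [signedLabel, Int.natAbs_mul, Int.natAbs_pow]

theorem layeredLabel_swap (k : ℕ) (a b : Fin 4) :
    layeredLabel k b a = - layeredLabel k a b := by
  fin_cases a <;> fin_cases b <;> simp [layeredLabel]

theorem natAbs_layeredLabel (k : ℕ) (a b : Fin 4) (h : a ≠ b) :
    2 ≤ (layeredLabel k a b).natAbs ∧ (layeredLabel k a b).natAbs ≤ k + 4 ∧
      (¬ (a = 0 ∧ b = 1) → ¬ (a = 1 ∧ b = 0) → (layeredLabel k a b).natAbs < k + 4) := by
  fin_cases a <;> fin_cases b <;> simp [layeredLabel] at h ⊢ <;> (try split_ifs) <;> omega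

theorem layeredGlue_zero_right (m : ℕ) (t u : Fin m) (h : (t : ℕ) = u + 1) :
    layeredGlue m t 0 = some (u, layerPerm₀) ∧ layeredGlue m t 1 = some (u, layerPerm₁) := by
  simp [layeredGlue_eq_some, h]

/-- Apart from the edge `01`, the edges of each tetrahedron are also edges of the previous one. -/
theorem exists_edgeRel_pred (m : ℕ) (t u : Fin m) (h : (t : ℕ) = u + 1) (a b : Fin 4)
    (hab : a ≠ b) (h₁ : ¬ (a = 0 ∧ b = 1)) (h₂ : ¬ (a = 1 ∧ b = 0)) :
    ∃ a' b', a' ≠ b' ∧ EdgeRel (layeredGlue m) (t, a, b) (u, a', b') := by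
  obtain ⟨g₀, g₁⟩ := layeredGlue_zero_right m t u h
  by_cases h0 : a ≠ 0 ∧ b ≠ 0
  · exact ⟨_, _, layerPerm₀.injective.ne hab, .of_glue g₀ hab h0.1 h0.2⟩
  · have ha : a ≠ 1 := by
      rintro rfl
      exact h0 ⟨by decide, fun hb => h₂ ⟨rfl, hb⟩⟩
    have hb : b ≠ 1 := by
      rintro rfl
      exact h0 ⟨fun ha => h₁ ⟨ha, rfl⟩, by decide⟩
    exact ⟨_, _, layerPerm₁.injective.ne hab, .of_glue g₁ hab ha hb⟩

-- The fold sends 0 → 2 → 3 → 1, so an edge class of the first tetrahedron is a chain of at most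
-- three edges, and two of its members differ by at most two folds in one direction. An edge can be
-- folded only if it avoids vertex 1.
set_option synthInstance.maxSize 1024 in
theorem layeredLabel_zero_cases : ∀ a b a' b' : Fin 4, a ≠ b → a' ≠ b' →
    layeredLabel 0 a b = layeredLabel 0 a' b' →
    (a = a' ∧ b = b') ∨
    (a ≠ 1 ∧ b ≠ 1 ∧ foldPerm a = a' ∧ foldPerm b = b') ∨
    (a' ≠ 1 ∧ b' ≠ 1 ∧ foldPerm a' = a ∧ foldPerm b' = b) ∨
    (a ≠ 1 ∧ b ≠ 1 ∧ foldPerm a ≠ 1 ∧ foldPerm b ≠ 1 ∧ foldPerm (foldPerm a) = a' ∧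
      foldPerm (foldPerm b) = b') ∨
    (a' ≠ 1 ∧ b' ≠ 1 ∧ foldPerm a' ≠ 1 ∧ foldPerm b' ≠ 1 ∧ foldPerm (foldPerm a') = a ∧
      foldPerm (foldPerm b') = b) := by
  decide

/-- Induction on the layers: tetrahedron `N + 1` contributes a single new class, its edge 01, with
the largest label `N + 5` in absolute value. Edges with smaller labels are pushed down to earlier
layers, where the induction hypothesis applies. -/
theorem edgeRel_of_signedLabel_eq (m N : ℕ) : ∀ (t t' : Fin m), (t : ℕ) ≤ N → (t' : ℕ) ≤ N →
    ∀ a b a' b', a ≠ b → a' ≠ b' → signedLabel t a b = signedLabel t' a' b' →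
    EdgeRel (layeredGlue m) (t, a, b) (t', a', b') := by
  induction N with
  | zero =>
    intro t t' ht ht' a b a' b' hab hab' h
    have h0 : (t : ℕ) = 0 := by omega
    have htt : t' = t := Fin.ext (by omega)
    subst htt
    have hg : layeredGlue m t' 1 = some (t', foldPerm) := by simp [layeredGlue_eq_some, h0]
    simp only [signedLabel, h0, pow_zero, one_mul] at h
    rcases layeredLabel_zero_cases a b a' b' hab hab' h with
      ⟨rfl, rfl⟩ | ⟨h₁, h₂, rfl, rfl⟩ | ⟨h₁, h₂, rfl, rfl⟩ | ⟨h₁, h₂, h₃, h₄, rfl, rfl⟩ |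
      ⟨h₁, h₂, h₃, h₄, rfl, rfl⟩
    · exact .refl _
    · exact .of_glue hg hab h₁ h₂
    · exact (EdgeRel.of_glue hg hab' h₁ h₂).symm
    · exact (EdgeRel.of_glue hg hab h₁ h₂).trans
        (.of_glue hg (foldPerm.injective.ne hab) h₃ h₄)
    · exact ((EdgeRel.of_glue hg hab' h₁ h₂).trans
        (.of_glue hg (foldPerm.injective.ne hab') h₃ h₄)).symm
  | succ N ih =>
    have down : ∀ (t : Fin m) (a b : Fin 4), (t : ℕ) ≤ N + 1 → a ≠ b →
        (signedLabel t a b).natAbs < N + 5 → ∃ (u : Fin m) (a' b' : Fin 4), (u : ℕ) ≤ N ∧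
          a' ≠ b' ∧ EdgeRel (layeredGlue m) (t, a, b) (u, a', b') := by
      intro t a b ht hab hl
      by_cases htN : (t : ℕ) ≤ N
      · exact ⟨t, a, b, htN, hab, .refl _⟩
      · have htN' : (t : ℕ) = N + 1 := by omega
        rw [natAbs_signedLabel, htN'] at hl
        obtain ⟨a', b', h₁, h₂⟩ := exists_edgeRel_pred m t ⟨N, by omega⟩ htN' a b hab
          (by rintro ⟨rfl, rfl⟩; simp [layeredLabel] at hl; omega)
          (by rintro ⟨rfl, rfl⟩; simp [layeredLabel] at hl; omega)
        exact ⟨_, a', b', le_rfl, h₁, h₂⟩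
    have top : ∀ (t : Fin m) (a b : Fin 4), (t : ℕ) ≤ N + 1 → a ≠ b →
        ¬ (signedLabel t a b).natAbs < N + 5 →
        (t : ℕ) = N + 1 ∧ ((a = 0 ∧ b = 1) ∨ (a = 1 ∧ b = 0)) := by
      intro t a b ht hab hl
      rw [natAbs_signedLabel] at hl
      have := natAbs_layeredLabel t a b hab
      refine ⟨by omega, ?_⟩
      by_contra hc
      rw [not_or] at hc
      have := this.2.2 hc.1 hc.2
      omega
    intro t t' ht ht' a b a' b' hab hab' h
    by_cases hl : (signedLabel t a b).natAbs < N + 5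
    · obtain ⟨u, c, d, hu, hcd, hr⟩ := down t a b ht hab hl
      obtain ⟨u', c', d', hu', hcd', hr'⟩ := down t' a' b' ht' hab' (h ▸ hl)
      refine hr.trans ((ih u u' hu hu' c d c' d' hcd hcd' ?_).trans hr'.symm)
      have e := hr.label_eq (fun i => signedLabel i) (layeredGlue_label m)
      have e' := hr'.label_eq (fun i => signedLabel i) (layeredGlue_label m)
      simp only at e e'
      rw [← e, ← e', h]
    · obtain ⟨h₁, h₂⟩ := top t a b ht hab hl
      obtain ⟨h₁', h₂'⟩ := top t' a' b' ht' hab' (h ▸ hl)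
      have htt : t' = t := Fin.ext (by omega)
      subst htt
      have h0 : layeredLabel t' a b = layeredLabel t' a' b' :=
        mul_left_cancel₀ (pow_ne_zero _ (by norm_num)) h
      rcases h₂ with ⟨rfl, rfl⟩ | ⟨rfl, rfl⟩ <;> rcases h₂' with ⟨rfl, rfl⟩ | ⟨rfl, rfl⟩
      · exact .refl _
      · simp [layeredLabel] at h0
        omega
      · simp [layeredLabel] at h0
        omega
      · exact .refl _

theorem layered_edgeRel_iff (m : ℕ) (t t' : Fin m) (a b a' b' : Fin 4) (hab : a ≠ b)
    (hab' : a' ≠ b') : EdgeRel (layeredGlue m) (t, a, b) (t', a', b') ↔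
      signedLabel t a b = signedLabel t' a' b' :=
  ⟨fun hr => hr.label_eq (fun i => signedLabel i) (layeredGlue_label m),
    fun hl => edgeRel_of_signedLabel_eq m m t t' t.2.le t'.2.le a b a' b' hab hab' hl⟩

/-! ### Edge classes of the plug -/

/-- The oriented edge reached from `e` by crossing the faces in the list `l`, one after the other;
faces that do not contain the current edge and boundary faces are not crossed. -/
def edgeWalk (g : Gluing ι) : ι × Fin 4 × Fin 4 → List (Fin 4) → ι × Fin 4 × Fin 4
  | e, [] => e
  | e, f :: l =>
    if e.2.1 ≠ f ∧ e.2.2 ≠ f then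
      match g e.1 f with
      | some (u, σ) => edgeWalk g (u, σ e.2.1, σ e.2.2) l
      | none => edgeWalk g e l
    else edgeWalk g e l

theorem edgeRel_edgeWalk (g : Gluing ι) (l : List (Fin 4)) (e : ι × Fin 4 × Fin 4)
    (he : e.2.1 ≠ e.2.2) : EdgeRel g e (edgeWalk g e l) := by
  induction l generalizing e with
  | nil => exact .refl _
  | cons f l ih =>
    rw [edgeWalk]
    split_ifs with h
    · split
      · next u σ hg =>
        exact (EdgeRel.of_glue hg he h.1 h.2).trans (ih _ (σ.injective.ne he))
      · exact ih e he
    · exact ih e he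

/-- A representative of an edge class of the plug and a list of faces that are crossed when going
around this edge. -/
def plugWalk : Fin 6 → (Fin 4 × Fin 4 × Fin 4) × List (Fin 4) :=
  ![((0, 0, 1), [2, 0, 1]), ((0, 0, 2), [1, 3, 0, 2, 2]), ((3, 2, 0), [1, 1, 2]),
    ((3, 1, 2), [3, 0, 3, 2]), ((3, 3, 2), [1, 3, 3]), ((3, 1, 3), [])]

theorem plugWalk_ne : ∀ c, (plugWalk c).1.2.1 ≠ (plugWalk c).1.2.2 := by decide

theorem plugLabel_plugWalk : ∀ c : Fin 6,
    plugLabel (plugWalk c).1.1 (plugWalk c).1.2.1 (plugWalk c).1.2.2 = (c : ℕ) + 1 := by decide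

/-- Every positively labelled edge occurs on a walk that starts at a representative of a class. The
six walks thus certify that the labels of the plug are complete; negative labels follow by reversing
edges. -/
theorem exists_plugWalk : ∀ t a b : Fin 4, 0 < plugLabel t a b → ∃ (c : Fin 6) (k : Fin 6),
    edgeWalk plugGlue (plugWalk c).1 ((plugWalk c).2.take k) = (t, a, b) := by
  decide

theorem EdgeRel.swap {g : Gluing ι} {p q : ι × Fin 4 × Fin 4} (h : EdgeRel g p q) :
    EdgeRel g (p.1, p.2.2, p.2.1) (q.1, q.2.2, q.2.1) := by
  induction h with
  | rel p q h =>
    obtain ⟨hne, f, σ, h1, h2, h3, h4, h5⟩ := h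
    exact .rel _ _ ⟨hne.symm, f, σ, h2, h1, h3, h5, h4⟩
  | refl p => exact .refl _
  | symm p q _ ih => exact ih.symm
  | trans p q r _ _ ih1 ih2 => exact ih1.trans ih2

theorem plugLabel_swap : ∀ t a b : Fin 4, plugLabel t b a = - plugLabel t a b := by decide

theorem plugLabel_bound : ∀ t a b : Fin 4, a ≠ b →
    plugLabel t a b ≠ 0 ∧ -6 ≤ plugLabel t a b ∧ plugLabel t a b ≤ 6 := by decide

theorem plugGlue_label (t f u : Fin 4) (σ : Equiv.Perm (Fin 4)) (h : plugGlue t f = some (u, σ))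
    (a b : Fin 4) (hab : a ≠ b) (ha : a ≠ f) (hb : b ≠ f) :
    plugLabel u (σ a) (σ b) = plugLabel t a b :=
  (plugGlue_spec t f (u, σ) h).2.2 a b hab ha hb

theorem plug_edgeRel_iff (t t' a b a' b' : Fin 4) (h : a ≠ b) :
    EdgeRel plugGlue (t, a, b) (t', a', b') ↔ plugLabel t a b = plugLabel t' a' b' := by
  refine ⟨fun hr => hr.label_eq plugLabel plugGlue_label, fun hl => ?_⟩
  have key : ∀ t a b t' a' b' : Fin 4, 0 < plugLabel t a b →
      plugLabel t a b = plugLabel t' a' b' → EdgeRel plugGlue (t, a, b) (t', a', b') := by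
    intro t a b t' a' b' h0 hl
    obtain ⟨c, k, hk⟩ := exists_plugWalk t a b h0
    obtain ⟨c', k', hk'⟩ := exists_plugWalk t' a' b' (hl ▸ h0)
    have hr := edgeRel_edgeWalk plugGlue ((plugWalk c).2.take k) _ (plugWalk_ne c)
    have hr' := edgeRel_edgeWalk plugGlue ((plugWalk c').2.take k') _ (plugWalk_ne c')
    rw [hk] at hr
    rw [hk'] at hr'
    have e := hr.label_eq plugLabel plugGlue_label
    have e' := hr'.label_eq plugLabel plugGlue_label
    rw [plugLabel_plugWalk] at e e'
    have hc : c = c' := Fin.ext (by simp only at e e'; omega)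
    subst hc
    exact hr.symm.trans hr'
  rcases lt_or_gt_of_ne (plugLabel_bound t a b h).1 with hneg | hpos
  · exact (key t b a t' b' a' (by rw [plugLabel_swap]; omega)
      (by rw [plugLabel_swap, plugLabel_swap t' a', hl])).swap
  · exact key t a b t' a' b' hpos hl

/-! ### The closed triangulations -/

/-- `(013) ↦ (213)` -/
def capPerm₂ : Equiv.Perm (Fin 4) := mkPerm ![2, 1, 0, 3] ![2, 1, 0, 3]
/-- `(012) ↦ (301)` -/
def capPerm₃ : Equiv.Perm (Fin 4) := mkPerm ![3, 0, 1, 2] ![1, 2, 3, 0]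

/-- The gluings of the layered solid torus with `m + 1` tetrahedra and of the plug, together with
`m(013) ↦ 3(213)` and `m(012) ↦ 3(301)`, where the tetrahedra `m` and `3` are the ones of the
layered solid torus and of the plug that meet the boundary. -/
def cappedGlue (m : ℕ) : Gluing (Fin (m + 1 + 4)) := Fin.addCases
  (fun i f => match layeredGlue (m + 1) i f with
    | some (u, σ) => some (u.castAdd 4, σ)
    | none => some (Fin.natAdd (m + 1) 3, if f = 2 then capPerm₂ else capPerm₃))
  (fun j f => match plugGlue j f with
    | some (u, σ) => some (Fin.natAdd (m + 1) u, σ)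
    | none => some ((Fin.last m).castAdd 4, if f = 0 then capPerm₂.symm else capPerm₃.symm))

theorem layeredGlue_eq_none (m : ℕ) (i : Fin (m + 1)) (f : Fin 4) :
    layeredGlue (m + 1) i f = none ↔ i = Fin.last m ∧ (f = 2 ∨ f = 3) := by
  obtain ⟨i, hi⟩ := i
  fin_cases f <;> simp [layeredGlue, Fin.ext_iff] <;> (try split_ifs) <;> (try simp) <;> omega

theorem plugGlue_eq_none : ∀ j f : Fin 4, plugGlue j f = none ↔ j = 3 ∧ (f = 0 ∨ f = 2) := by
  decide

/-- The six kinds of face gluings. -/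
inductive CappedGluing (m : ℕ) :
    Fin (m + 1 + 4) → Fin 4 → Fin (m + 1 + 4) → Equiv.Perm (Fin 4) → Prop
  | layered {i f u σ} (h : layeredGlue (m + 1) i f = some (u, σ)) :
      CappedGluing m (i.castAdd 4) f (u.castAdd 4) σ
  | plug {j f u σ} (h : plugGlue j f = some (u, σ)) :
      CappedGluing m (Fin.natAdd (m + 1) j) f (Fin.natAdd (m + 1) u) σ
  | cap₂ : CappedGluing m ((Fin.last m).castAdd 4) 2 (Fin.natAdd (m + 1) 3) capPerm₂
  | cap₃ : CappedGluing m ((Fin.last m).castAdd 4) 3 (Fin.natAdd (m + 1) 3) capPerm₃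
  | cap₂_symm : CappedGluing m (Fin.natAdd (m + 1) 3) 0 ((Fin.last m).castAdd 4) capPerm₂.symm
  | cap₃_symm : CappedGluing m (Fin.natAdd (m + 1) 3) 2 ((Fin.last m).castAdd 4) capPerm₃.symm

theorem cappedGlue_layered {m : ℕ} {i : Fin (m + 1)} {f : Fin 4} {u : Fin (m + 1)}
    {σ : Equiv.Perm (Fin 4)} (h : layeredGlue (m + 1) i f = some (u, σ)) :
    cappedGlue m (i.castAdd 4) f = some (u.castAdd 4, σ) := by
  simp [cappedGlue, h]

theorem cappedGlue_plug {m : ℕ} {j f u : Fin 4} {σ : Equiv.Perm (Fin 4)}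
    (h : plugGlue j f = some (u, σ)) :
    cappedGlue m (Fin.natAdd (m + 1) j) f = some (Fin.natAdd (m + 1) u, σ) := by
  simp [cappedGlue, h]

theorem cappedGlue_last {m : ℕ} {f : Fin 4} (h : f = 2 ∨ f = 3) :
    cappedGlue m ((Fin.last m).castAdd 4) f =
      some (Fin.natAdd (m + 1) 3, if f = 2 then capPerm₂ else capPerm₃) := by
  simp [cappedGlue, (layeredGlue_eq_none m (Fin.last m) f).2 ⟨rfl, h⟩]

theorem cappedGlue_plug_boundary {m : ℕ} {f : Fin 4} (h : f = 0 ∨ f = 2) :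
    cappedGlue m (Fin.natAdd (m + 1) 3) f =
      some ((Fin.last m).castAdd 4, if f = 0 then capPerm₂.symm else capPerm₃.symm) := by
  simp [cappedGlue, (plugGlue_eq_none 3 f).2 ⟨rfl, h⟩]

theorem cappedGlue_eq_some {m : ℕ} {t : Fin (m + 1 + 4)} {f : Fin 4} {u : Fin (m + 1 + 4)}
    {σ : Equiv.Perm (Fin 4)} :
    cappedGlue m t f = some (u, σ) ↔ CappedGluing m t f u σ := by
  constructor
  · intro h
    induction t using Fin.addCases with
    | left i =>
      rcases hg : layeredGlue (m + 1) i f with _ | ⟨u', σ'⟩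
      · obtain ⟨rfl, hf⟩ := (layeredGlue_eq_none m i f).1 hg
        rw [cappedGlue_last hf] at h
        rcases hf with rfl | rfl <;> simp at h <;> obtain ⟨rfl, rfl⟩ := h
        · exact .cap₂
        · exact .cap₃
      · rw [cappedGlue_layered hg] at h
        simp only [Option.some.injEq, Prod.mk.injEq] at h
        obtain ⟨rfl, rfl⟩ := h
        exact .layered hg
    | right j =>
      rcases hg : plugGlue j f with _ | ⟨u', σ'⟩
      · obtain ⟨rfl, hf⟩ := (plugGlue_eq_none j f).1 hg
        rw [cappedGlue_plug_boundary hf] at h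
        rcases hf with rfl | rfl <;> simp at h <;> obtain ⟨rfl, rfl⟩ := h
        · exact .cap₂_symm
        · exact .cap₃_symm
      · rw [cappedGlue_plug hg] at h
        simp only [Option.some.injEq, Prod.mk.injEq] at h
        obtain ⟨rfl, rfl⟩ := h
        exact .plug hg
  · rintro (h | h | _ | _ | _ | _)
    · exact cappedGlue_layered h
    · exact cappedGlue_plug h
    · simp [cappedGlue_last]
    · simp [cappedGlue_last]
    · simp [cappedGlue_plug_boundary]
    · simp [cappedGlue_plug_boundary]

theorem castAdd_ne_natAdd {m n : ℕ} (i : Fin m) (j : Fin n) : i.castAdd n ≠ Fin.natAdd m j := by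
  rw [Ne, Fin.ext_iff]
  simp only [Fin.val_castAdd, Fin.val_natAdd]
  omega

/-- The label of an edge of the capped triangulation whose label in the plug is `v`, up to
sign: the boundary edges `4`, `5`, `6` of the plug are the edges `m + 4`, `m + 3`, `m + 2` of the
layered solid torus. -/
def plugShift (m : ℕ) (v : ℤ) : ℤ :=
  if 3 < v then v - m - 8 else if 0 < v then v + m + 4 else if -4 < v then v - m - 4 else v + m + 8

/-- A complete invariant of the oriented edges of the capped triangulation. -/
def cappedLabel (m : ℕ) (t : Fin (m + 1 + 4)) (a b : Fin 4) : ℤ := Fin.addCases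
  (fun i => signedLabel i a b) (fun j => (-1) ^ m * plugShift m (plugLabel j a b)) t

@[simp]
theorem cappedLabel_castAdd (m : ℕ) (i : Fin (m + 1)) (a b : Fin 4) :
    cappedLabel m (i.castAdd 4) a b = signedLabel i a b := by
  simp [cappedLabel]

@[simp]
theorem cappedLabel_natAdd (m : ℕ) (j : Fin 4) (a b : Fin 4) :
    cappedLabel m (Fin.natAdd (m + 1) j) a b = (-1) ^ m * plugShift m (plugLabel j a b) := by
  simp [cappedLabel]

/-- The caps pair the plug labels 4, 5, 6 with negative labels of the last layer, hence the change
of sign in `plugShift`. The factor (-1)^m in `cappedLabel` is the sign that `signedLabel` has in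
that layer. -/
theorem cappedLabel_cap₂ (m : ℕ) (a b : Fin 4) (hab : a ≠ b) (ha : a ≠ 2) (hb : b ≠ 2) :
    plugShift m (plugLabel 3 (capPerm₂ a) (capPerm₂ b)) = layeredLabel m a b := by
  fin_cases a <;> fin_cases b <;>
    simp [capPerm₂, mkPerm, layeredLabel, plugLabel, plugShift] at hab ha hb ⊢ <;> ring

theorem cappedLabel_cap₃ (m : ℕ) (a b : Fin 4) (hab : a ≠ b) (ha : a ≠ 3) (hb : b ≠ 3) :
    plugShift m (plugLabel 3 (capPerm₃ a) (capPerm₃ b)) = layeredLabel m a b := by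
  fin_cases a <;> fin_cases b <;>
    simp [capPerm₃, mkPerm, layeredLabel, plugLabel, plugShift] at hab ha hb ⊢ <;> ring

theorem cappedLabel_step (m : ℕ) (t : Fin (m + 1 + 4)) (f : Fin 4) (u : Fin (m + 1 + 4))
    (σ : Equiv.Perm (Fin 4)) (h : cappedGlue m t f = some (u, σ)) (a b : Fin 4) (hab : a ≠ b)
    (ha : a ≠ f) (hb : b ≠ f) : cappedLabel m u (σ a) (σ b) = cappedLabel m t a b := by
  rw [cappedGlue_eq_some] at h
  rcases h with h | h | _ | _ | _ | _
  · simpa [signedLabel] using layeredGlue_label _ _ _ _ _ h a b hab ha hb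
  · simp [plugGlue_label _ _ _ _ h a b hab ha hb]
  · simp [cappedLabel_cap₂ m a b hab ha hb, signedLabel]
  · simp [cappedLabel_cap₃ m a b hab ha hb, signedLabel]
  · have := cappedLabel_cap₂ m (capPerm₂.symm a) (capPerm₂.symm b)
      (capPerm₂.symm.injective.ne hab) (capPerm₂.symm.injective.ne ha)
      (capPerm₂.symm.injective.ne hb)
    simp only [Equiv.apply_symm_apply] at this
    simp [this, signedLabel]
  · have := cappedLabel_cap₃ m (capPerm₃.symm a) (capPerm₃.symm b)
      (capPerm₃.symm.injective.ne hab) (capPerm₃.symm.injective.ne ha)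
      (capPerm₃.symm.injective.ne hb)
    simp only [Equiv.apply_symm_apply] at this
    simp [this, signedLabel]

theorem cappedLabel_ne_zero (m : ℕ) (t : Fin (m + 1 + 4)) (a b : Fin 4) (hab : a ≠ b) :
    cappedLabel m t a b ≠ 0 := by
  induction t using Fin.addCases with
  | left i =>
    have := natAbs_layeredLabel i a b hab
    rw [cappedLabel_castAdd, ← Int.natAbs_ne_zero, natAbs_signedLabel]
    omega
  | right j =>
    rw [cappedLabel_natAdd]
    refine mul_ne_zero (pow_ne_zero _ (by norm_num)) ?_
    have := plugLabel_bound j a b hab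
    rw [plugShift]
    split_ifs <;> omega

theorem cappedLabel_swap (m : ℕ) (t : Fin (m + 1 + 4)) (a b : Fin 4) (hab : a ≠ b) :
    cappedLabel m t b a = - cappedLabel m t a b := by
  induction t using Fin.addCases with
  | left i => simp [signedLabel, layeredLabel_swap i a b]
  | right j =>
    rw [cappedLabel_natAdd, cappedLabel_natAdd, plugLabel_swap, ← mul_neg]
    congr 1
    have := plugLabel_bound j a b hab
    simp only [plugShift]
    split_ifs <;> omega

/-- The layered solid torus with `m + 1` tetrahedra, closed up by the plug. -/
def capped (m : ℕ) : Triangulation (Fin (m + 1 + 4)) where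
  glue := cappedGlue m
  glue_symm t f u σ h := by
    rw [cappedGlue_eq_some] at h ⊢
    rcases h with h | h | _ | _ | _ | _
    · exact .layered (layeredGlue_symm _ _ _ _ _ h)
    · exact .plug (plug.glue_symm _ _ _ _ h)
    · exact .cap₂_symm
    · exact .cap₃_symm
    · exact .cap₂
    · exact .cap₃
  glue_ne t f u σ h := by
    rw [cappedGlue_eq_some] at h
    rcases h with h | h | _ | _ | _ | _
    · simpa using layeredGlue_ne _ _ _ _ _ h
    · simpa using plug.glue_ne _ _ _ _ h
    all_goals simp [castAdd_ne_natAdd, (castAdd_ne_natAdd _ _).symm]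
  no_reverse := no_reverse_of_label _ (cappedLabel m)
    (fun t a b hab => ⟨cappedLabel_ne_zero m t a b hab, cappedLabel_swap m t a b hab⟩)
    (cappedLabel_step m)

theorem capped_isClosed (m : ℕ) : (capped m).IsClosed := by
  intro t f
  change cappedGlue m t f ≠ none
  induction t using Fin.addCases with
  | left i =>
    simp only [cappedGlue, Fin.addCases_left]
    split <;> simp
  | right j =>
    simp only [cappedGlue, Fin.addCases_right]
    split <;> simp

/-! ### The vertex -/

/-- The fold alone identifies all four vertices of the first tetrahedron. Each vertex of a later
tetrahedron, and of the plug, is carried to the base vertex `r` through a chain of glued faces. -/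
theorem capped_isOneVertex (m : ℕ) : (capped m).IsOneVertex := by
  let r : Fin (m + 1 + 4) × Fin 4 := (Fin.castAdd 4 0, 0)
  have step : ∀ {t u f σ}, CappedGluing m t f u σ → ∀ v, v ≠ f →
      (capped m).VertexRel (u, σ v) r → (capped m).VertexRel (t, v) r := fun h v hv hr =>
    .trans _ _ _ (.rel _ _ ⟨_, _, hv, cappedGlue_eq_some.2 h, rfl⟩) hr
  have layered : ∀ (k : ℕ) (hk : k < m + 1) (v : Fin 4),
      (capped m).VertexRel (Fin.castAdd 4 ⟨k, hk⟩, v) r := by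
    intro k
    induction k with
    | zero =>
      intro hk v
      have g₀ : layeredGlue (m + 1) ⟨0, hk⟩ 0 = some (⟨0, hk⟩, foldPerm.symm) := by
        simp [layeredGlue_eq_some]
      have h₀ : (capped m).VertexRel (Fin.castAdd 4 ⟨0, hk⟩, 0) r := .refl _
      have h₂ := step (.layered g₀) 2 (by decide) h₀
      have h₃ := step (.layered g₀) 3 (by decide) h₂
      have h₁ := step (.layered g₀) 1 (by decide) h₃
      fin_cases v
      exacts [h₀, h₁, h₂, h₃]
    | succ k ih =>
      intro hk v
      obtain ⟨g₀, g₁⟩ := layeredGlue_zero_right (m + 1) ⟨k + 1, hk⟩ ⟨k, by omega⟩ rfl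
      by_cases hv : v = 0
      · exact step (.layered g₁) v (by rw [hv]; decide) (ih _ _)
      · exact step (.layered g₀) v hv (ih _ _)
  have h₃ : ∀ v, (capped m).VertexRel (Fin.natAdd (m + 1) 3, v) r := by
    intro v
    by_cases hv : v = 0
    · exact step .cap₃_symm v (by rw [hv]; decide) (layered _ _ _)
    · exact step .cap₂_symm v hv (layered _ _ _)
  have p : ∀ {j f u σ}, plugGlue j f = some (u, σ) → ∀ v, v ≠ f →
      (capped m).VertexRel (Fin.natAdd (m + 1) u, σ v) r →
      (capped m).VertexRel (Fin.natAdd (m + 1) j, v) r := fun h => step (.plug h)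
  have h₁ : ∀ v, v ≠ 3 → (capped m).VertexRel (Fin.natAdd (m + 1) 1, v) r := fun v hv =>
    p (j := 1) (f := 3) rfl v hv (h₃ v)
  have h₀ : ∀ v, (capped m).VertexRel (Fin.natAdd (m + 1) 0, v) r := by
    intro v
    by_cases hv : v = 1 ∨ v = 2
    · exact p (j := 0) (f := 0) rfl v (by rcases hv with rfl | rfl <;> decide)
        (h₁ v (by rcases hv with rfl | rfl <;> decide))
    · have hv' : v = 0 ∨ v = 3 := by omega
      exact p (j := 0) (f := 2) rfl v (by rcases hv' with rfl | rfl <;> decide)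
        (h₁ _ (by rcases hv' with rfl | rfl <;> decide))
  have all : ∀ q, (capped m).VertexRel q r := by
    rintro ⟨t, v⟩
    induction t using Fin.addCases with
    | left i => exact layered i i.2 v
    | right j =>
      fin_cases j
      · exact h₀ v
      · by_cases hv : v = 3
        · exact p (j := 1) (f := 0) rfl v (by rw [hv]; decide) (h₀ v)
        · exact h₁ v hv
      · by_cases hv : v = 0
        · exact p (j := 2) (f := 1) rfl v (by rw [hv]; decide) (h₀ v)
        · exact p (j := 2) (f := 0) rfl v hv (h₀ _)
      · exact h₃ v
  exact ⟨⟨Fin.castAdd 4 0⟩, fun q₁ q₂ => .trans _ _ _ (all q₁) (.symm _ _ (all q₂))⟩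

/-! ### The edges -/

theorem EdgeRel.map_castAdd {m : ℕ} {p q : Fin (m + 1) × Fin 4 × Fin 4}
    (h : EdgeRel (layeredGlue (m + 1)) p q) :
    EdgeRel (cappedGlue m) (p.1.castAdd 4, p.2) (q.1.castAdd 4, q.2) := by
  induction h with
  | rel p q h =>
    obtain ⟨hne, f, σ, h1, h2, h3, h4, h5⟩ := h
    exact .rel _ _ ⟨hne, f, σ, h1, h2, cappedGlue_layered h3, h4, h5⟩
  | refl p => exact .refl _
  | symm p q _ ih => exact ih.symm
  | trans p q r _ _ ih1 ih2 => exact ih1.trans ih2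

theorem EdgeRel.map_natAdd {m : ℕ} {p q : Fin 4 × Fin 4 × Fin 4}
    (h : EdgeRel plugGlue p q) :
    EdgeRel (cappedGlue m) (Fin.natAdd (m + 1) p.1, p.2) (Fin.natAdd (m + 1) q.1, q.2) := by
  induction h with
  | rel p q h =>
    obtain ⟨hne, f, σ, h1, h2, h3, h4, h5⟩ := h
    exact .rel _ _ ⟨hne, f, σ, h1, h2, cappedGlue_plug h3, h4, h5⟩
  | refl p => exact .refl _
  | symm p q _ ih => exact ih.symm
  | trans p q r _ _ ih1 ih2 => exact ih1.trans ih2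

theorem plugShift_injective (m : ℕ) (v w : ℤ) (hv : v ≠ 0 ∧ -6 ≤ v ∧ v ≤ 6)
    (hw : w ≠ 0 ∧ -6 ≤ w ∧ w ≤ 6) (h : plugShift m v = plugShift m w) : v = w := by
  simp only [plugShift] at h
  split_ifs at h <;> omega

/-- An edge of the plug with label at least `4` is identified with an edge of the last tetrahedron
of the layered solid torus. -/
theorem exists_edgeRel_last (m : ℕ) (j a b : Fin 4) (hab : a ≠ b)
    (h : plugLabel j a b < -3 ∨ 3 < plugLabel j a b) : ∃ a' b', a' ≠ b' ∧
      EdgeRel (cappedGlue m) (Fin.natAdd (m + 1) j, a, b) ((Fin.last m).castAdd 4, a', b') := by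
  -- The face 123 of tetrahedron 3 of the plug contains a representative of each boundary edge
  -- class.
  have hb : ∀ j a b : Fin 4, plugLabel j a b < -3 ∨ 3 < plugLabel j a b →
      ∃ a' b', a' ≠ b' ∧ a' ≠ 0 ∧ b' ≠ 0 ∧ plugLabel j a b = plugLabel 3 a' b' := by decide
  obtain ⟨a', b', hab', ha, hb, hl⟩ := hb j a b h
  have h₁ := ((plug_edgeRel_iff j 3 a b a' b' hab).2 hl).map_natAdd (m := m)
  have h₂ := EdgeRel.of_glue (cappedGlue_eq_some.2 (.cap₂_symm (m := m))) hab' ha hb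
  exact ⟨_, _, capPerm₂.symm.injective.ne hab', h₁.trans h₂⟩

theorem capped_edgeRel_of_label_eq (m : ℕ) (t : Fin (m + 1 + 4)) (a b : Fin 4)
    (t' : Fin (m + 1 + 4)) (a' b' : Fin 4) (hab : a ≠ b) (hab' : a' ≠ b')
    (h : cappedLabel m t a b = cappedLabel m t' a' b') :
    EdgeRel (cappedGlue m) (t, a, b) (t', a', b') := by
  -- The labels in the torus are at most `m + 4` in absolute value, whereas interior edges of the
  -- plug have labels from `m + 5` on. Only boundary edges of the plug can share a label with the
  -- torus.
  have mixed : ∀ (i : Fin (m + 1)) (j a b a' b' : Fin 4), a ≠ b → a' ≠ b' →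
      cappedLabel m (i.castAdd 4) a b = cappedLabel m (Fin.natAdd (m + 1) j) a' b' →
      EdgeRel (cappedGlue m) (i.castAdd 4, a, b) (Fin.natAdd (m + 1) j, a', b') := by
    intro i j a b a' b' hab hab' h
    have hl : plugLabel j a' b' < -3 ∨ 3 < plugLabel j a' b' := by
      have h₁ := congrArg Int.natAbs h
      have h₂ := natAbs_layeredLabel i a b hab
      have h₃ := plugLabel_bound j a' b' hab'
      rw [cappedLabel_castAdd, cappedLabel_natAdd, natAbs_signedLabel, Int.natAbs_mul,
        Int.natAbs_pow, plugShift] at h₁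
      simp only [Int.natAbs_neg, Int.natAbs_one, one_pow, one_mul] at h₁
      split_ifs at h₁ <;> omega
    obtain ⟨c, d, hcd, hr⟩ := exists_edgeRel_last m j a' b' hab' hl
    have e := hr.label_eq (cappedLabel m) (cappedLabel_step m)
    simp only at e
    rw [e, cappedLabel_castAdd, cappedLabel_castAdd] at h
    exact (((layered_edgeRel_iff (m + 1) i (Fin.last m) a b c d hab hcd).2 h).map_castAdd).trans
      hr.symm
  induction t using Fin.addCases with
  | left i =>
    induction t' using Fin.addCases with
    | left i' =>
      rw [cappedLabel_castAdd, cappedLabel_castAdd] at h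
      exact ((layered_edgeRel_iff (m + 1) i i' a b a' b' hab hab').2 h).map_castAdd
    | right j' => exact mixed i j' a b a' b' hab hab' h
  | right j =>
    induction t' using Fin.addCases with
    | left i' => exact (mixed i' j a' b' a b hab' hab h.symm).symm
    | right j' =>
      rw [cappedLabel_natAdd, cappedLabel_natAdd] at h
      exact ((plug_edgeRel_iff j j' a b a' b' hab).2 (plugShift_injective m _ _
        (plugLabel_bound j a b hab) (plugLabel_bound j' a' b' hab')
        (mul_left_cancel₀ (pow_ne_zero _ (by norm_num)) h))).map_natAdd

theorem exists_natAbs_cappedLabel (m l : ℕ) (h : 2 ≤ l) (h' : l ≤ m + 7) :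
    ∃ t a b, a ≠ b ∧ (cappedLabel m t a b).natAbs = l := by
  have aux : ∀ j a b, (cappedLabel m (Fin.natAdd (m + 1) j) a b).natAbs =
      (plugShift m (plugLabel j a b)).natAbs := fun j a b => by
    simp [Int.natAbs_mul, Int.natAbs_pow]
  by_cases h₄ : l ≤ m + 4
  · by_cases h₂ : l = 2
    · refine ⟨Fin.castAdd 4 0, 0, 2, by decide, ?_⟩
      rw [cappedLabel_castAdd, natAbs_signedLabel, h₂]
      rfl
    by_cases h₃ : l = 3
    · refine ⟨Fin.castAdd 4 0, 0, 3, by decide, ?_⟩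
      rw [cappedLabel_castAdd, natAbs_signedLabel, h₃]
      rfl
    refine ⟨Fin.castAdd 4 ⟨l - 4, by omega⟩, 0, 1, by decide, ?_⟩
    rw [cappedLabel_castAdd, natAbs_signedLabel]
    simp [layeredLabel]
    omega
  · obtain rfl | rfl | rfl : l = m + 5 ∨ l = m + 6 ∨ l = m + 7 := by omega
    · refine ⟨Fin.natAdd (m + 1) 0, 0, 1, by decide, ?_⟩
      rw [aux]
      simp [plugShift, plugLabel]
      omega
    · refine ⟨Fin.natAdd (m + 1) 0, 0, 2, by decide, ?_⟩
      rw [aux]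
      simp [plugShift, plugLabel]
      omega
    · refine ⟨Fin.natAdd (m + 1) 0, 0, 3, by decide, ?_⟩
      rw [aux]
      simp [plugShift, plugLabel]
      omega

/-- The edge classes of the capped triangulation. -/
def cappedLabelling (m : ℕ) : (capped m).EdgeLabelling (Finset.Icc 2 (m + 7)) where
  label := cappedLabel m
  ne_zero := cappedLabel_ne_zero m
  swap := cappedLabel_swap m
  step := cappedLabel_step m
  complete := capped_edgeRel_of_label_eq m
  mem_iff l := by
    rw [Finset.mem_Icc]
    constructor
    · rintro ⟨h, h'⟩
      obtain ⟨t, a, b, hab, hl⟩ := exists_natAbs_cappedLabel m l h h'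
      rcases Int.natAbs_eq_iff.1 hl with hl | hl
      · exact ⟨t, a, b, hab, hl⟩
      · exact ⟨t, b, a, hab.symm, by rw [cappedLabel_swap m t a b hab, hl, neg_neg]⟩
    · rintro ⟨t, a, b, hab, hl⟩
      have hl := congrArg Int.natAbs hl
      induction t using Fin.addCases with
      | left i =>
        have := natAbs_layeredLabel i a b hab
        have := i.2
        rw [cappedLabel_castAdd, natAbs_signedLabel, Int.natAbs_natCast] at hl
        omega
      | right j =>
        have := plugLabel_bound j a b hab
        rw [cappedLabel_natAdd, Int.natAbs_mul, Int.natAbs_pow, plugShift] at hl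
        simp only [Int.natAbs_neg, Int.natAbs_one, one_pow, one_mul, Int.natAbs_natCast] at hl
        split_ifs at hl <;> omega

theorem capped_isBoundaryUnion (m : ℕ) :
    Triangulation.IsBoundaryUnion (layeredSolidTorus (m + 1)) plug (capped m) := by
  refine ⟨finSumFinEquiv, fun t f u σ h => ?_, fun t f u σ h => ?_, fun t f h => ?_,
    fun t f h => ?_, ?_⟩
  · exact cappedGlue_layered h
  · exact cappedGlue_plug h
  · obtain ⟨rfl, hf⟩ := (layeredGlue_eq_none m t f).1 h
    refine ⟨3, _, ?_, cappedGlue_last hf⟩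
    refine (plugGlue_eq_none _ _).2 ⟨rfl, ?_⟩
    rcases hf with rfl | rfl <;> decide
  · obtain ⟨rfl, hf⟩ := (plugGlue_eq_none t f).1 h
    refine ⟨Fin.last m, _, ?_, cappedGlue_plug_boundary hf⟩
    refine (layeredGlue_eq_none _ _ _).2 ⟨rfl, ?_⟩
    rcases hf with rfl | rfl <;> decide
  -- Identification is equality of labels on both sides, and the cap relates the two labels by the
  -- injective map `plugShift`.
  · intro t f u σ t' f' u' σ' hf hf' hg hg' a b a' b' hab ha hb hab' ha' hb'
    have e := cappedLabel_step m _ _ _ _ hg a b hab ha hb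
    have e' := cappedLabel_step m _ _ _ _ hg' a' b' hab' ha' hb'
    simp only [finSumFinEquiv_apply_left, finSumFinEquiv_apply_right, cappedLabel_castAdd,
      cappedLabel_natAdd] at e e'
    refine (layered_edgeRel_iff _ _ _ _ _ _ _ hab hab').trans
      (Iff.trans ?_ (plug_edgeRel_iff _ _ _ _ _ _ (σ.injective.ne hab)).symm)
    rw [← e, ← e', mul_right_inj' (pow_ne_zero _ (by norm_num))]
    exact ⟨plugShift_injective m _ _ (plugLabel_bound _ _ _ (σ.injective.ne hab))
      (plugLabel_bound _ _ _ (σ'.injective.ne hab')), fun h => by rw [h]⟩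

theorem capped_isClosedManifold (m : ℕ) : (capped m).IsClosedManifold :=
  (capped_isOneVertex m).isClosedManifold (capped_isClosed m) (cappedLabelling m) (by simp)

open Triangulation

/-! ### The normal surfaces -/

/-- The coordinates in the layered solid torus: `s` copies of the meridian disc. -/
def layeredCoord (s k : ℕ) : Disc → ℕ :=
  Sum.elim ![s * Nat.fib (k + 2), s * Nat.fib (k + 2), 0, 0] ![0, s * Nat.fib (k + 1), 0]

/-- The coordinates in the plug. -/
def plugCoord (p q r : ℕ) : Fin 4 → Disc → ℕ :=
  ![Sum.elim ![p, 0, 0, p] ![0, r, 0], Sum.elim ![p, 0, r, 0] ![0, 0, p],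
    Sum.elim ![p, 0, 0, r] ![0, p, 0], Sum.elim ![2 * p, 0, 2 * p, 0] ![q, 0, 0]]

/-- The surface that consists of `s` meridian discs of the layered solid torus and a surface in the
plug; it satisfies the matching equations if `2 * p = s * Nat.fib (m + 3)`. -/
def cappedSurface (m s p : ℕ) : Fin (m + 1 + 4) → Disc → ℕ := Fin.addCases
  (fun i => layeredCoord s i) (plugCoord p (s * Nat.fib (m + 2)) (s * Nat.fib (m + 4)))

@[simp]
theorem cappedSurface_castAdd (m s p : ℕ) (i : Fin (m + 1)) :
    cappedSurface m s p (i.castAdd 4) = layeredCoord s i := by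
  simp [cappedSurface]

@[simp]
theorem cappedSurface_natAdd (m s p : ℕ) (j : Fin 4) :
    cappedSurface m s p (Fin.natAdd (m + 1) j) =
      plugCoord p (s * Nat.fib (m + 2)) (s * Nat.fib (m + 4)) j := by
  simp [cappedSurface]

theorem mul_fib_add_two (s k : ℕ) :
    s * Nat.fib (k + 2) = s * Nat.fib k + s * Nat.fib (k + 1) := by
  rw [Nat.fib_add_two, mul_add]

/-- Between consecutive layers the equations are the Fibonacci recursion; at the fold they reduce to
F_1 = F_2. -/
theorem matching_layeredCoord (m s : ℕ) :
    (layeredSolidTorus m).Matching fun i => layeredCoord s i := by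
  intro t f u σ h v hv
  replace h : layeredGlue m t f = some (u, σ) := h
  have e := mul_fib_add_two s
  rw [layeredGlue_eq_some] at h
  rcases h with ⟨rfl, h1, h2, rfl⟩ | ⟨rfl, h1, h2, rfl⟩ | ⟨rfl, h, rfl⟩ | ⟨rfl, h, rfl⟩ |
    ⟨rfl, h, rfl⟩ | ⟨rfl, h, rfl⟩ <;>
  fin_cases v <;>
  simp [*, foldPerm, layerPerm₀, layerPerm₁, mkPerm, arcCount, layeredCoord, quadOf] at hv ⊢ <;>
  grind

theorem matching_plugCoord (p q r : ℕ) (h : 2 * p + q = r) :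
    plug.Matching (plugCoord p q r) := by
  intro t f u σ hg v hv
  replace hg : plugGlue t f = some (u, σ) := hg
  subst h
  fin_cases t <;> fin_cases f <;> simp [plugGlue] at hg <;> obtain ⟨rfl, rfl⟩ := hg <;>
    fin_cases v <;>
    simp [plugPerm₁, plugPerm₂, mkPerm, arcCount, plugCoord, quadOf] at hv ⊢ <;> omega

/-- The discs leave s F_{m+3}, s F_{m+2} and 0 arcs at the vertices 0, 1 and 3 of this face, while
tetrahedron 3 of the plug offers 2p, q and 0. This is the origin of the condition on `p`. -/
theorem matching_cap₂ (m s p : ℕ) (h : 2 * p = s * Nat.fib (m + 3)) (v : Fin 4) (hv : v ≠ 2) :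
    arcCount (layeredCoord s m) 2 v =
      arcCount (plugCoord p (s * Nat.fib (m + 2)) (s * Nat.fib (m + 4)) 3) 0 (capPerm₂ v) := by
  have e : s * Nat.fib (m + 3) = s * Nat.fib (m + 1) + s * Nat.fib (m + 2) :=
    mul_fib_add_two s (m + 1)
  fin_cases v <;> simp [capPerm₂, mkPerm, arcCount, plugCoord, layeredCoord, quadOf] at hv ⊢
  all_goals omega

theorem matching_cap₃ (m s p : ℕ) (h : 2 * p = s * Nat.fib (m + 3)) (v : Fin 4) (hv : v ≠ 3) :
    arcCount (layeredCoord s m) 3 v =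
      arcCount (plugCoord p (s * Nat.fib (m + 2)) (s * Nat.fib (m + 4)) 3) 2 (capPerm₃ v) := by
  have e : s * Nat.fib (m + 3) = s * Nat.fib (m + 1) + s * Nat.fib (m + 2) :=
    mul_fib_add_two s (m + 1)
  fin_cases v <;> simp [capPerm₃, mkPerm, arcCount, plugCoord, layeredCoord, quadOf] at hv ⊢
  all_goals omega

theorem matching_cappedSurface (m s p : ℕ) (h : 2 * p = s * Nat.fib (m + 3)) :
    (capped m).Matching (cappedSurface m s p) := by
  intro t f u σ hg v hv
  replace hg := cappedGlue_eq_some.1 hg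
  rcases hg with hg | hg | _ | _ | _ | _
  · simpa using matching_layeredCoord (m + 1) s _ _ _ _ hg v hv
  · simpa using matching_plugCoord p _ _ (by rw [h, mul_fib_add_two s (m + 2), add_comm])
      _ _ _ _ hg v hv
  · simpa using! matching_cap₂ m s p h v hv
  · simpa using! matching_cap₃ m s p h v hv
  · simpa using! (matching_cap₂ m s p h (capPerm₂.symm v) (capPerm₂.symm.injective.ne hv)).symm
  · simpa using! (matching_cap₃ m s p h (capPerm₃.symm v) (capPerm₃.symm.injective.ne hv)).symm

theorem isNormal_cappedSurface (m s p : ℕ) (h : 2 * p = s * Nat.fib (m + 3)) :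
    (capped m).IsNormal (cappedSurface m s p) := by
  refine ⟨matching_cappedSurface m s p h, fun t q q' hq hq' => ?_⟩
  induction t using Fin.addCases with
  | left i =>
    rw [cappedSurface_castAdd] at hq hq'
    fin_cases q <;> fin_cases q' <;> simp [layeredCoord] at hq hq' ⊢
  | right j =>
    rw [cappedSurface_natAdd] at hq hq'
    fin_cases j <;> fin_cases q <;> fin_cases q' <;> simp [plugCoord] at hq hq' ⊢

/-! ### Extremality -/

/-- The solutions in the layered solid torus whose support is that of the meridian disc are its
multiples. -/
theorem layered_solution (m : ℕ) (y : Fin (m + 1) → Disc → ℝ)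
    (hy : ∀ t f u σ, layeredGlue (m + 1) t f = some (u, σ) → ∀ v, v ≠ f →
      arcCount (y t) f v = arcCount (y u) (σ f) (σ v))
    (h₂ : ∀ i, y i (.inl 2) = 0) (h₃ : ∀ i, y i (.inl 3) = 0) (hq₀ : ∀ i, y i (.inr 0) = 0)
    (hq₂ : ∀ i, y i (.inr 2) = 0) (k : ℕ) (hk : k < m + 1) :
    y ⟨k, hk⟩ (.inl 0) = y 0 (.inr 1) * Nat.fib (k + 2) ∧
    y ⟨k, hk⟩ (.inl 1) = y 0 (.inr 1) * Nat.fib (k + 2) ∧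
    y ⟨k, hk⟩ (.inr 1) = y 0 (.inr 1) * Nat.fib (k + 1) := by
  induction k with
  | zero =>
    have g₁ : layeredGlue (m + 1) ⟨0, hk⟩ 1 = some (⟨0, hk⟩, foldPerm) := by
      simp [layeredGlue_eq_some]
    have e₀ := hy _ 1 _ _ g₁ 0 (by decide)
    have e₃ := hy _ 1 _ _ g₁ 3 (by decide)
    simp [arcCount, quadOf, foldPerm, mkPerm, h₂, h₃, hq₀] at e₀ e₃
    simp [e₀, ← e₃]
  | succ k ih =>
    obtain ⟨g₀, g₁⟩ := layeredGlue_zero_right (m + 1) ⟨k + 1, hk⟩ ⟨k, by omega⟩ rfl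
    obtain ⟨ih₀, ih₁, ihq⟩ := ih (by omega)
    have e₁ := hy _ _ _ _ g₀ 1 (by decide)
    have e₂ := hy _ _ _ _ g₀ 2 (by decide)
    have e₀ := hy _ _ _ _ g₁ 0 (by decide)
    simp [arcCount, quadOf, layerPerm₀, layerPerm₁, mkPerm, h₂, hq₀, hq₂] at e₀ e₁ e₂
    rw [ih₀, ihq] at e₁
    rw [ih₁, ihq] at e₀
    rw [ih₁] at e₂
    have hf := Nat.fib_add_two (n := k + 1)
    rw [e₀, e₁, e₂, show k + 1 + 2 = k + 1 + 1 + 1 from rfl, hf]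
    push_cast
    refine ⟨by ring, by ring, rfl⟩

/-- The solutions in the plug whose support is that of `plugCoord p q r` are determined by their
coordinates in the tetrahedron that meets the boundary. -/
theorem plug_solution (p q r : ℕ) (hr : 2 * p + q = r) (e : ℝ) (y : Fin 4 → Disc → ℝ)
    (hy : ∀ t f u σ, plugGlue t f = some (u, σ) → ∀ v, v ≠ f →
      arcCount (y t) f v = arcCount (y u) (σ f) (σ v))
    (hz : ∀ j c, plugCoord p q r j c = 0 → y j c = 0) (h₀ : y 3 (.inl 0) = e * (2 * p))
    (h₂ : y 3 (.inl 2) = e * (2 * p)) (hq : y 3 (.inr 0) = e * q) (j : Fin 4) (c : Disc) :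
    y j c = e * plugCoord p q r j c := by
  -- Nine equations for the nine possibly nonzero coordinates in tetrahedra 0, 1, 2: those of size
  -- `r` are read off directly, and the other six are equal in value and add up in pairs to `e * (2
  -- * p)`.
  have a₂ := hy 0 0 _ _ rfl 2 (by decide)
  have a₃ := hy 0 0 _ _ rfl 3 (by decide)
  have b₀ := hy 0 1 _ _ rfl 0 (by decide)
  have b₃ := hy 0 1 _ _ rfl 3 (by decide)
  have c₀ := hy 0 2 _ _ rfl 0 (by decide)
  have d₀ := hy 1 3 _ _ rfl 0 (by decide)
  have d₂ := hy 1 3 _ _ rfl 2 (by decide)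
  have f₀ := hy 2 2 _ _ rfl 0 (by decide)
  have f₃ := hy 2 2 _ _ rfl 3 (by decide)
  simp [arcCount, quadOf, plugPerm₁, mkPerm, h₀, h₂, hq, hz 0 (.inl 2) rfl, hz 0 (.inr 0) rfl,
    hz 0 (.inr 2) rfl, hz 1 (.inl 3) rfl, hz 1 (.inr 0) rfl, hz 1 (.inr 1) rfl,
    hz 2 (.inr 0) rfl, hz 3 (.inr 2) rfl] at a₂ a₃ b₀ b₃ c₀ d₀ d₂ f₀ f₃
  have hr' : (r : ℝ) = 2 * p + q := by exact_mod_cast hr.symm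
  by_cases hc : plugCoord p q r j c = 0
  · rw [hz j c hc, hc]
    simp
  · fin_cases j <;> rcases c with c | c <;> fin_cases c <;> simp [plugCoord, hr'] at hc ⊢ <;>
      linarith

theorem isExtreme_cappedSurface (m s p : ℕ) (h : 2 * p = s * Nat.fib (m + 3)) (hs : s ≠ 0) :
    IsExtreme ℝ (capped m).solutionCone (ray (toReal (cappedSurface m s p))) := by
  refine isExtreme_ray (toReal_mem_solutionCone (matching_cappedSurface m s p h)) ?_
  intro y hy h0
  have hL : ∀ (i : Fin (m + 1)) d, layeredCoord s i d = 0 → y (Fin.castAdd 4 i) d = 0 := fun i d hd =>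
    h0 _ d (by simp [toReal, hd])
  have hP : ∀ j d, plugCoord p (s * Nat.fib (m + 2)) (s * Nat.fib (m + 4)) j d = 0 →
      y (Fin.natAdd (m + 1) j) d = 0 := fun j d hd => h0 _ d (by simp [toReal, hd])
  have hlay := layered_solution m (fun i => y (Fin.castAdd 4 i))
    (fun t f u σ hg v hv => hy.2 _ _ _ _ (cappedGlue_layered hg) v hv)
    (fun i => hL i _ rfl) (fun i => hL i _ rfl) (fun i => hL i _ rfl) (fun i => hL i _ rfl)
  set d := y (Fin.castAdd 4 0) (.inr 1) with hd
  have hs' : (s : ℝ) ≠ 0 := Nat.cast_ne_zero.2 hs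
  have hp : (p : ℝ) = s * Nat.fib (m + 3) / 2 := by
    rw [eq_div_iff two_ne_zero, mul_comm]
    exact_mod_cast h
  -- The quadrilateral coordinate of the surface in the first tetrahedron is s F_1 = s, and that of
  -- `y` is `d`.
  refine ⟨d / s, div_nonneg (hy.1 _ _) (Nat.cast_nonneg s), ?_⟩
  funext t c
  rw [Pi.smul_apply, Pi.smul_apply, smul_eq_mul]
  simp only [toReal]
  induction t using Fin.addCases with
  | left i =>
    obtain ⟨l₀, l₁, lq⟩ := hlay i i.2
    rw [cappedSurface_castAdd]
    by_cases hc : layeredCoord s i c = 0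
    · rw [hL i c hc, hc]
      simp
    · rcases c with c | c <;> fin_cases c <;> simp [layeredCoord] at hc ⊢
      · rw [← mul_assoc, div_mul_cancel₀ _ hs']
        exact l₀
      · rw [← mul_assoc, div_mul_cancel₀ _ hs']
        exact l₁
      · rw [← mul_assoc, div_mul_cancel₀ _ hs']
        exact lq
  | right j =>
    obtain ⟨l₀, l₁, lq⟩ := hlay m (Nat.lt_succ_self m)
    change y (Fin.castAdd 4 (Fin.last m)) _ = _ at l₀ l₁ lq
    have c₂ := hy.2 _ _ _ _ (cappedGlue_eq_some.2 (.cap₂ (m := m)))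
    have c₃ := hy.2 _ _ _ _ (cappedGlue_eq_some.2 (.cap₃ (m := m)))
    have e₀ := c₂ 0 (by decide)
    have e₁ := c₂ 1 (by decide)
    have e₂ := c₃ 1 (by decide)
    have hq₂ := hL (Fin.last m) (.inr 2) rfl
    have k₁ := hP 3 (.inl 1) rfl
    have kq := hP 3 (.inr 1) rfl
    simp [arcCount, quadOf, mkPerm, capPerm₂, capPerm₃, hq₂, k₁, kq] at e₀ e₁ e₂
    have hf : Nat.fib (m + 3) = Nat.fib (m + 1) + Nat.fib (m + 2) := Nat.fib_add_two
    have hf' : (Nat.fib (m + 3) : ℝ) = Nat.fib (m + 1) + Nat.fib (m + 2) := by exact_mod_cast hf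
    have hdp : d / s * (2 * p) = d * Nat.fib (m + 3) := by
      rw [hp]
      field_simp
    rw [cappedSurface_natAdd]
    refine plug_solution p _ _ (by rw [h, mul_fib_add_two s (m + 2), add_comm]) (d / s)
      (fun j => y (Fin.natAdd (m + 1) j))
      (fun t f u σ hg v hv => hy.2 _ _ _ _ (cappedGlue_plug hg) v hv) hP ?_ ?_ ?_ j c
    · rw [hdp, hf', ← e₂]
      linear_combination l₁ + lq
    · rw [hdp, hf', ← e₀]
      linear_combination l₀ + lq
    · rw [← e₁, Nat.cast_mul, ← mul_assoc, div_mul_cancel₀ _ hs']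
      exact l₁

/-- Both `s` and `p` occur as coordinates. If `c` times the surface is integral, then Bézout's
identity for `s` and `p` makes `c` an integer, and `c` is at least 1 unless the multiple vanishes.
-/
theorem isVertexNormal_cappedSurface (m s p : ℕ) (h : 2 * p = s * Nat.fib (m + 3)) (hs : s ≠ 0)
    (hsp : Nat.Coprime s p) : (capped m).IsVertexNormal (cappedSurface m s p) := by
  have x₀ : cappedSurface m s p (Fin.castAdd 4 0) (.inl 0) = s := by
    simp [layeredCoord]
  have x₁ : cappedSurface m s p (Fin.natAdd (m + 1) 0) (.inl 0) = p := by
    simp [plugCoord]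
  refine ⟨isNormal_cappedSurface m s p h, fun h0 => hs ?_, isExtreme_cappedSurface m s p h hs, ?_⟩
  · rw [← x₀, h0]
    rfl
  · rintro z hz ⟨c, hc, he⟩
    have he : ∀ t d, (z t d : ℝ) = c * cappedSurface m s p t d := fun t d =>
      congrFun (congrFun he t) d
    have h₀ := he (Fin.castAdd 4 0) (.inl 0)
    have h₁ := he (Fin.natAdd (m + 1) 0) (.inl 0)
    rw [x₀] at h₀
    rw [x₁] at h₁
    have hb := Nat.gcd_eq_gcd_ab s p
    rw [hsp.gcd_eq_one] at hb
    have hb' : (1 : ℝ) = s * Nat.gcdA s p + p * Nat.gcdB s p := by exact_mod_cast hb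
    have hcz : c = ((z (Fin.castAdd 4 0) (.inl 0) * Nat.gcdA s p +
        z (Fin.natAdd (m + 1) 0) (.inl 0) * Nat.gcdB s p : ℤ) : ℝ) := by
      push_cast
      rw [h₀, h₁]
      linear_combination c * hb'
    generalize (z (Fin.castAdd 4 0) (.inl 0) * Nat.gcdA s p +
        z (Fin.natAdd (m + 1) 0) (.inl 0) * Nat.gcdB s p : ℤ) = k at hcz
    subst hcz
    have hk : k ≠ 0 := by
      rintro rfl
      refine hz (funext fun t => funext fun d => ?_)
      have := he t d
      simp only [Int.cast_zero, zero_mul, Nat.cast_eq_zero] at this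
      exact this
    have hk1 : 1 ≤ k := by
      have : 0 ≤ k := by exact_mod_cast hc
      omega
    intro t d
    have h1 : (1 : ℝ) ≤ k := by exact_mod_cast hk1
    have h2 := he t d
    have h3 : (cappedSurface m s p t d : ℝ) ≤ z t d := by
      rw [h2]
      exact le_mul_of_one_le_left (Nat.cast_nonneg _) h1
    exact_mod_cast h3

/-! ### Euler characteristic -/

/-- The number of intersection points with the edge of label `l`. -/
def cappedWeight (m s p l : ℕ) : ℕ :=
  if l ≤ m + 4 then s * Nat.fib l else if l = m + 5 then p + s * Nat.fib (m + 4)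
  else if l = m + 6 then p else 2 * p + s * Nat.fib (m + 4)

theorem edgeWeight_layeredCoord (s k : ℕ) (a b : Fin 4) (hab : a ≠ b) :
    edgeWeight (layeredCoord s k) a b = s * Nat.fib (layeredLabel k a b).natAbs := by
  have n₄ : ((k : ℤ) + 4).natAbs = k + 4 := by omega
  have n₃ : ((k : ℤ) + 3).natAbs = k + 3 := by omega
  have n₂ : ((k : ℤ) + 2).natAbs = k + 2 := by omega
  have n₁ : (if k = 0 then 2 else (k : ℤ) + 1).natAbs = if k = 0 then 2 else k + 1 := by
    split_ifs <;> omega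
  -- In the first tetrahedron the fold gives edge 23 the label 2 instead of `k + 1 = 1`; the weight
  -- is unaffected since F_1 = F_2.
  have f₁ : s * Nat.fib (if k = 0 then 2 else k + 1) = s * Nat.fib (k + 1) := by
    split_ifs with h
    · rw [h]
      rfl
    · rfl
  have f₄ : s * Nat.fib (k + 4) = s * Nat.fib (k + 2) + s * Nat.fib (k + 3) :=
    mul_fib_add_two s (k + 2)
  have f₃ : s * Nat.fib (k + 3) = s * Nat.fib (k + 1) + s * Nat.fib (k + 2) :=
    mul_fib_add_two s (k + 1)
  fin_cases a <;> fin_cases b <;>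
    simp [edgeWeight, layeredCoord, layeredLabel, quadOf, Finset.sum_filter, Fin.sum_univ_three,
      -neg_add_rev, n₄, n₃, n₂, n₁, f₁] at hab ⊢
  all_goals omega

theorem edgeWeight_plugCoord (m s p : ℕ) (h : 2 * p = s * Nat.fib (m + 3)) (j a b : Fin 4)
    (hab : a ≠ b) :
    edgeWeight (plugCoord p (s * Nat.fib (m + 2)) (s * Nat.fib (m + 4)) j) a b =
      cappedWeight m s p (plugShift m (plugLabel j a b)).natAbs := by
  have f₄ : s * Nat.fib (m + 4) = s * Nat.fib (m + 2) + s * Nat.fib (m + 3) :=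
    mul_fib_add_two s (m + 2)
  have key : ∀ v : ℤ, v ≠ 0 ∧ -6 ≤ v ∧ v ≤ 6 →
      cappedWeight m s p (plugShift m v).natAbs =
        if v.natAbs = 1 then p + s * Nat.fib (m + 4) else if v.natAbs = 2 then p
        else if v.natAbs = 3 then 2 * p + s * Nat.fib (m + 4)
        else s * Nat.fib (m + 8 - v.natAbs) := by
    intro v hv
    by_cases h₃ : v.natAbs ≤ 3
    · have hl : (plugShift m v).natAbs = m + 4 + v.natAbs := by
        rw [plugShift]
        split_ifs <;> omega
      obtain h | h | h : v.natAbs = 1 ∨ v.natAbs = 2 ∨ v.natAbs = 3 := by omega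
      all_goals simp [hl, h, cappedWeight]
    · have hl : (plugShift m v).natAbs = m + 8 - v.natAbs := by
        rw [plugShift]
        split_ifs <;> omega
      rw [hl, cappedWeight, if_pos (by omega), if_neg (by omega), if_neg (by omega),
        if_neg (by omega)]
  rw [key _ (plugLabel_bound j a b hab)]
  fin_cases j <;> fin_cases a <;> fin_cases b <;>
    simp [edgeWeight, plugCoord, plugLabel, quadOf, Finset.sum_filter, Fin.sum_univ_three]
      at hab ⊢
  all_goals omega

theorem edgeWeight_cappedSurface (m s p : ℕ) (h : 2 * p = s * Nat.fib (m + 3))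
    (t : Fin (m + 1 + 4)) (a b : Fin 4) (hab : a ≠ b) :
    edgeWeight (cappedSurface m s p t) a b =
      cappedWeight m s p (cappedLabel m t a b).natAbs := by
  induction t using Fin.addCases with
  | left i =>
    have := natAbs_layeredLabel i a b hab
    rw [cappedSurface_castAdd, cappedLabel_castAdd, natAbs_signedLabel,
      edgeWeight_layeredCoord s i a b hab, cappedWeight, if_pos (by omega)]
  | right j =>
    rw [cappedSurface_natAdd, cappedLabel_natAdd, edgeWeight_plugCoord m s p h j a b hab,
      Int.natAbs_mul, Int.natAbs_pow]
    simp

theorem sum_Icc_mul_fib (s m : ℕ) :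
    (∑ l ∈ Finset.Icc 2 (m + 4), s * Nat.fib l) + 2 * s = s * Nat.fib (m + 6) := by
  induction m with
  | zero =>
    simp [Finset.sum_Icc_succ_top, Nat.fib_add_two]
    ring
  | succ m ih =>
    rw [show m + 1 + 4 = m + 4 + 1 from rfl, Finset.sum_Icc_succ_top (by omega)]
    have : s * Nat.fib (m + 7) = s * Nat.fib (m + 5) + s * Nat.fib (m + 6) :=
      mul_fib_add_two s (m + 5)
    rw [show m + 1 + 6 = m + 7 from rfl, this, show m + 4 + 1 = m + 5 from rfl]
    omega

theorem sum_cappedWeight (m s p : ℕ) :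
    (∑ l ∈ Finset.Icc 2 (m + 7), cappedWeight m s p l) + 2 * s =
      s * Nat.fib (m + 6) + 4 * p + 2 * (s * Nat.fib (m + 4)) := by
  rw [Finset.sum_Icc_succ_top (by omega), Finset.sum_Icc_succ_top (by omega),
    Finset.sum_Icc_succ_top (by omega), Finset.sum_congr rfl (g := fun l => s * Nat.fib l)]
  · have := sum_Icc_mul_fib s m
    simp [cappedWeight]
    omega
  · intro l hl
    rw [cappedWeight, if_pos (Finset.mem_Icc.1 hl).2]

theorem sum_layeredCoord (m s : ℕ) :
    (∑ i : Fin (m + 1), ((∑ v, layeredCoord s i (.inl v)) + 2 * ∑ q, layeredCoord s i (.inr q))) +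
      6 * s = 2 * (s * Nat.fib (m + 5)) := by
  rw [Fin.sum_univ_eq_sum_range (fun i => (∑ v, layeredCoord s i (.inl v)) +
    2 * ∑ q, layeredCoord s i (.inr q))]
  induction m with
  | zero =>
    simp [layeredCoord, Fin.sum_univ_four, Fin.sum_univ_three, Nat.fib_add_two]
    ring
  | succ m ih =>
    rw [Finset.sum_range_succ]
    have e₆ : s * Nat.fib (m + 1 + 5) = s * Nat.fib (m + 4) + s * Nat.fib (m + 5) :=
      mul_fib_add_two s (m + 4)
    have e₄ : s * Nat.fib (m + 4) = s * Nat.fib (m + 1 + 1) + s * Nat.fib (m + 1 + 2) :=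
      mul_fib_add_two s (m + 2)
    simp only [layeredCoord, Fin.sum_univ_four, Fin.sum_univ_three] at ih ⊢
    simp at ih ⊢
    omega

/-- By the Fibonacci recursion, twice the vertex count minus the weighted piece count collapses to
2s + 2s F_{m+3} - 4p, and the last two terms cancel. -/
theorem eulerChar_cappedSurface (m s p : ℕ) (h : 2 * p = s * Nat.fib (m + 3)) :
    (capped m).eulerChar (cappedSurface m s p) = s := by
  have hχ := (cappedLabelling m).two_mul_eulerChar (capped_isClosed m) (cappedSurface m s p)
    (matching_cappedSurface m s p h) (cappedWeight m s p) (edgeWeight_cappedSurface m s p h)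
  have hw := sum_cappedWeight m s p
  have hl := sum_layeredCoord m s
  rw [Fin.sum_univ_add] at hχ
  simp only [cappedSurface_castAdd, cappedSurface_natAdd] at hχ
  have hp : ∑ j : Fin 4, ((∑ v, plugCoord p (s * Nat.fib (m + 2)) (s * Nat.fib (m + 4)) j
      (.inl v)) + 2 * ∑ q, plugCoord p (s * Nat.fib (m + 2)) (s * Nat.fib (m + 4)) j (.inr q)) =
      12 * p + 4 * (s * Nat.fib (m + 4)) + 2 * (s * Nat.fib (m + 2)) := by
    simp [plugCoord, Fin.sum_univ_four, Fin.sum_univ_three]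
    ring
  rw [hp] at hχ
  have e₆ : s * Nat.fib (m + 6) = s * Nat.fib (m + 4) + s * Nat.fib (m + 5) :=
    mul_fib_add_two s (m + 4)
  have e₄ : s * Nat.fib (m + 4) = s * Nat.fib (m + 2) + s * Nat.fib (m + 3) :=
    mul_fib_add_two s (m + 2)
  omega

theorem le_maxCoord_cappedSurface (m s p : ℕ) :
    s * Nat.fib (m + 2) ≤ maxCoord (cappedSurface m s p) := by
  have := Finset.le_sup (f := fun q : Fin (m + 1 + 4) × Disc => cappedSurface m s p q.1 q.2)
    (Finset.mem_univ ((Fin.last m).castAdd 4, .inl 0))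
  simpa [layeredCoord, maxCoord] using this

/-- The triangulations with no gluings. -/
def unglued (n : ℕ) : Triangulation (Fin n) where
  glue _ _ := none
  glue_symm _ _ _ _ h := nomatch h
  glue_ne _ _ _ _ h := nomatch h
  no_reverse := no_reverse_of_label _ (fun _ a b => (a : ℤ) - b)
    (fun _ a b hab => ⟨by rw [Ne, sub_eq_zero]; exact_mod_cast Fin.val_injective.ne hab, by ring⟩)
    (fun _ _ _ _ h => nomatch h)

/-- The family of closed triangulations, by the number of tetrahedra. -/
def cappedFamily : (n : ℕ) → Triangulation (Fin n)
  | m + 5 => capped m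
  | n => unglued n

end NormalSurf

/-! ### The choice of `s` and `p` by the parity of F_{m+3} -/

theorem theorem6 :
    ∃ C : (n : ℕ) → NormalSurf.Triangulation (Fin n), ∀ n : ℕ, 5 ≤ n →
      NormalSurf.Triangulation.IsBoundaryUnion
        (NormalSurf.layeredSolidTorus (n - 4)) NormalSurf.plug (C n) ∧
      (C n).IsClosed ∧ (C n).IsOneVertex ∧ (C n).IsClosedManifold ∧
      ∃ x : Fin n → NormalSurf.Disc → ℕ, (C n).IsVertexNormal x ∧
        (n % 3 = 2 → (C n).IsProjectivePlane x ∧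
          Nat.fib (n - 3) ≤ NormalSurf.Triangulation.maxCoord x) ∧
        (n % 3 ≠ 2 → (C n).IsSphere x ∧
          2 * Nat.fib (n - 3) ≤ NormalSurf.Triangulation.maxCoord x) := by
  open NormalSurf in
  refine ⟨cappedFamily, fun n hn => ?_⟩
  obtain ⟨m, rfl⟩ := Nat.exists_eq_add_of_le' hn
  refine ⟨capped_isBoundaryUnion m, capped_isClosed m, capped_isOneVertex m,
    capped_isClosedManifold m, ?_⟩
  by_cases h3 : (m + 5) % 3 = 2
  -- The divisor 2 is F_3, and 3 divides m + 3.
  · obtain ⟨p, hp⟩ : 2 ∣ Nat.fib (m + 3) := Nat.fib_dvd 3 (m + 3) (by omega)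
    have h : 2 * p = 1 * Nat.fib (m + 3) := by omega
    have hv := isVertexNormal_cappedSurface m 1 p h one_ne_zero (Nat.coprime_one_left p)
    refine ⟨cappedSurface m 1 p, hv, fun _ => ⟨⟨hv.isClosedConnectedSurface (capped_isClosed m),
      eulerChar_cappedSurface m 1 p h⟩, ?_⟩, fun hn3 => absurd h3 hn3⟩
    simpa using le_maxCoord_cappedSurface m 1 p
  · have hc : Nat.Coprime 2 (Nat.fib (m + 3)) := by
      -- gcd(F_3, F_{m+3}) = F_{gcd(3, m+3)} = F_1 = 1, so F_{m+3} is odd and can serve as `p` with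
      -- s = 2.
      have h1 : Nat.Coprime 3 (m + 3) := (Nat.Prime.coprime_iff_not_dvd Nat.prime_three).2 (by omega)
      have := Nat.fib_gcd 3 (m + 3)
      rw [h1.gcd_eq_one] at this
      exact this.symm
    have hv := isVertexNormal_cappedSurface m 2 _ rfl two_ne_zero hc
    exact ⟨cappedSurface m 2 _, hv, fun hn3 => absurd hn3 h3, fun _ =>
      ⟨⟨hv.isClosedConnectedSurface (capped_isClosed m), eulerChar_cappedSurface m 2 _ rfl⟩,
      le_maxCoord_cappedSurface m 2 _⟩⟩
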